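/- Let $G=(V,E)$ be a finite simple undirected graph. For $S\subseteq V$ and $v\in V$ let $d_S(v)$ be the number of neighbours of $v$ in $S$, and let $N(S)$ be the set of vertices outside $S$ that have a neighbour in $S$. A non-empty set $S\subseteq V$ is an offensive alliance in $G$ if $d_S(v)\ge d_{V\setminus S}(v)+1$ for all $v\in N(S)$. In the problem Offensive Alliance one is given such a graph $G$ and a positive integer $k$ (the solution size), and asks whether $G$ has an offensive alliance $S$ with $|S|\le k$. Assume the Exponential Time Hypothesis (ETH): there is a $\delta>0$ such that no algorithm decides the satisfiability of 3-CNF formulas with $n$ variables in time $2^{\delta n}\cdot |x|^{O(1)}$, where $|x|$ is the length of the input. Then Offensive Alliance cannot be solved in time $\mathcal{O}^{*}(2^{o(k\log k)})$; that is, there are no function $f:\mathbb{N}\to\mathbb{R}$ with $f(k)=o(k\log k)$ as $k\to\infty$, no polynomial $p$ and no algorithm that correctly decides every instance $x=(G,k)$ of Offensive Alliance in time at most $2^{f(k)}\cdot p(|x|)$. (Algorithms are deterministic multi-stack Turing machines; inputs are binary strings in which $G$ is given by its adjacency matrix and the parameter $k$ in unary, so that $|x|\ge k$.) -/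

import Mathlib

/-! ### Algorithms and running time

Algorithms are the multi-stack Turing machines `Turing.FinTM2`; the running time is the number of
applications of the step function until the machine halts with the answer on its output stack. -/

/-- The decision problem "given `x : α`, does `P x` hold?", whose instances are written as binary
strings by `enc`, can be solved in time `O*(T x)`: some Turing machine halts on every instance `x`
with the correct one-bit answer after at most `T x * p (|enc x|)` steps, for a polynomial `p` that
depends on the machine only. -/
def SolvableInOStar {α : Type} (enc : α → List Bool) (P : α → Prop) (T : α → ℝ) : Prop :=
  ∃ (M : Turing.TM2ComputableAux Bool Bool) (p : Polynomial ℕ), ∀ x : α, ∃ (b : Bool) (t : ℕ),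
    (b = true ↔ P x) ∧ (t : ℝ) ≤ T x * (p.eval (enc x).length : ℕ) ∧
    Nonempty (Turing.TM2OutputsInTime M.tm
      ((enc x).map M.inputAlphabet.symm) (some ([b].map M.outputAlphabet.symm)) t)

/-- The self-delimiting unary code `1…10` of a natural number. -/
def unaryCode (m : ℕ) : List Bool := List.replicate m true ++ [false]

/-! ### 3-SAT and the Exponential Time Hypothesis -/

/-- A 3-CNF formula over the variables `0, …, numVars - 1`: a list of clauses, each the disjunction
of three literals. A literal is a variable with its sign (`true` for the positive literal).
Literals may repeat within a clause, so clauses with one or two distinct literals are included. -/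
structure ThreeCNF where
  numVars : ℕ
  clauses : List (Fin 3 → Fin numVars × Bool)

namespace ThreeCNF

def Satisfiable (φ : ThreeCNF) : Prop :=
  ∃ a : Fin φ.numVars → Bool, ∀ c ∈ φ.clauses, ∃ i : Fin 3, a (c i).1 = (c i).2

/-- The number of variables in unary, followed by the literals of the clauses in order; a literal is
its sign bit followed by the unary code of its variable. -/
def encode (φ : ThreeCNF) : List Bool :=
  unaryCode φ.numVars ++
    φ.clauses.flatMap fun c => (List.finRange 3).flatMap fun i =>
      (c i).2 :: unaryCode ((c i).1 : ℕ)

end ThreeCNF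

/-- The Exponential Time Hypothesis: there is a `δ > 0` such that 3-SAT on formulas with `n`
variables cannot be solved in time `O*(2 ^ (δ n))`. -/
def ExponentialTimeHypothesis : Prop :=
  ∃ δ : ℝ, 0 < δ ∧
    ¬ SolvableInOStar ThreeCNF.encode ThreeCNF.Satisfiable
      (fun φ => (2 : ℝ) ^ (δ * (φ.numVars : ℝ)))

/-! ### Offensive alliances -/

namespace SimpleGraph

variable {V : Type*} [Fintype V] [DecidableEq V]

open Classical in
/-- `d_S(v)`: the number of neighbours of `v` in `S`. -/
noncomputable def degreeIn (G : SimpleGraph V) (S : Finset V) (v : V) : ℕ :=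
  (S.filter fun u => G.Adj v u).card

/-- `N(S)`: the vertices outside `S` that have a neighbour in `S`. -/
def openNeighborSet (G : SimpleGraph V) (S : Finset V) : Set V :=
  {v | v ∉ S ∧ ∃ u ∈ S, G.Adj u v}

/-- A nonempty set `S` with `d_S(v) ≥ d_{Sᶜ}(v) + 1` for all `v ∈ N(S)`. -/
def IsOffensiveAlliance (G : SimpleGraph V) (S : Finset V) : Prop :=
  S.Nonempty ∧ ∀ v ∈ G.openNeighborSet S, G.degreeIn S v ≥ G.degreeIn Sᶜ v + 1

end SimpleGraph

/-- An instance of Offensive Alliance: a finite simple graph, with vertices named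
`0, …, numVertices - 1`, and a positive integer `k`, the solution size. -/
structure OffensiveAllianceInstance where
  numVertices : ℕ
  graph : SimpleGraph (Fin numVertices)
  k : ℕ
  k_pos : 1 ≤ k

namespace OffensiveAllianceInstance

/-- The question: is there an offensive alliance of size at most `k`? -/
def IsYes (I : OffensiveAllianceInstance) : Prop :=
  ∃ S : Finset (Fin I.numVertices), I.graph.IsOffensiveAlliance S ∧ S.card ≤ I.k

open Classical in
/-- The number of vertices and the parameter in unary, followed by the adjacency matrix, row by
row. -/
noncomputable def encode (I : OffensiveAllianceInstance) : List Bool :=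
  unaryCode I.numVertices ++ unaryCode I.k ++
    (List.finRange I.numVertices).flatMap fun u =>
      (List.finRange I.numVertices).map fun v => decide (I.graph.Adj u v)

end OffensiveAllianceInstance

/-! The proof is a polynomial-time reduction from 3-SAT in which `n` variables produce a parameter
`k` with `k log k = O(n)`. An algorithm with exponent `o(k log k)` would then decide 3-SAT with
exponent `o(n)`, against ETH.

Cut the variables into `g` groups of `w ≈ log₄ n` variables. A group has `2 ^ w = O(√n)` partial
assignments; these and some dummies are its `h = 3 * 2 ^ w + g` candidates. One candidate per group
encodes an assignment. As `g = O(n / log n)`, the parameter `k = h + g` satisfies `k log k = O(n)`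
(`param_mul_log_le`).

The choice is enforced by a set system (`Selection.exists_majority_iff`). Every set consists of a
common block of `h` elements and a further part: the candidates of one group, or the at most `3 * 2
^ w` candidates that satisfy one clause, padded to `h` elements. Let `S` have at most `h + g`
elements and contain more than half of each set it meets. It cannot avoid the common block, so it
meets every set. If it misses `y` elements of the block, each group must supply at least `y + 1`, so
`h - y + g * (y + 1) ≤ h + g`, and `g ≥ 2` gives `y = 0`. Hence `S` is the block with one candidate
per group, and the majority condition for a clause says that a chosen candidate satisfies it.

Majorities become alliances in the incidence graph with `2k` copies of each set
(`incidenceGraph.exists_isOffensiveAlliance_iff`). Elements have degree at least `2k`, too large for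
membership in `N(S)` when `|S| ≤ k`; so a copy in `S` would drag in all of its more than `k`
elements. Thus `S` consists of elements, and the alliance condition at the copies is the majority
condition.

For the machine model, the reduction is written in a small language of stack programs that is
compiled and put in front of the given machine (`StackProg.host_outputs`). All numbers involved are
unary and polynomially bounded, so closure properties of `PolyFn`, `PolyPred` and `PolyWord` show
that the instance is computed in polynomial time (`polyWord_encode_toInstance`), and
`SolvableInOStar.of_reduction` transfers the time bound. -/

open Function (update)

/-! ### A structured language for stack machines -/

/-- Structured programs acting on stacks of bits indexed by `ℕ`. -/
inductive StackProg : Type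
  | skip : StackProg
  | push (k : ℕ) (a : Bool) : StackProg
  | seq (P Q : StackProg) : StackProg
  /-- Pop stack `k`; run `N`, `F` or `T` if the result is `none`, `some false`, `some true`. -/
  | ifPop (k : ℕ) (N F T : StackProg) : StackProg
  /-- As long as stack `k` is nonempty, pop it and run `F` or `T` according to the bit popped. -/
  | loop (k : ℕ) (F T : StackProg) : StackProg

namespace StackProg

/-- `Exec P s t s'`: started with the stacks `s`, the program `P` ends with the stacks `s'` after at
most `t` steps. -/
inductive Exec : StackProg → (ℕ → List Bool) → ℕ → (ℕ → List Bool) → Prop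
  | skip (s) : Exec skip s 1 s
  | push (k a s) : Exec (push k a) s 1 (update s k (a :: s k))
  | seq {P Q s t s' t' s''} : Exec P s t s' → Exec Q s' t' s'' → Exec (seq P Q) s (t + t') s''
  | ifPop_nil {k N F T s t s'} : s k = [] → Exec N s t s' → Exec (ifPop k N F T) s (t + 1) s'
  | ifPop_cons {k N F T s t s' a l} : s k = a :: l → Exec (cond a T F) (update s k l) t s' →
      Exec (ifPop k N F T) s (t + 1) s'
  | loop_nil {k F T s} : s k = [] → Exec (loop k F T) s 1 s
  | loop_cons {k F T s t s' t' s'' a l} : s k = a :: l → Exec (cond a T F) (update s k l) t s' →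
      Exec (loop k F T) s' t' s'' → Exec (loop k F T) s (t + t' + 1) s''
  | mono {P s t t' s'} : Exec P s t s' → t ≤ t' → Exec P s t' s'

theorem Exec.congr {P : StackProg} {s s' s'' : ℕ → List Bool} {t t' : ℕ} (h : Exec P s t s')
    (ht : t ≤ t') (hs : s' = s'') : Exec P s t' s'' :=
  hs ▸ h.mono ht

/-- An upper bound for the indices of the stacks a program uses. -/
def maxStack : StackProg → ℕ
  | skip => 0
  | push k _ => k
  | seq P Q => max P.maxStack Q.maxStack
  | ifPop k N F T => max k (max N.maxStack (max F.maxStack T.maxStack))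
  | loop k F T => max k (max F.maxStack T.maxStack)

/-! ### Compilation to Turing machines -/

/-- The labels of the machine compiled from a program. -/
inductive Label : StackProg → Type
  | skip : Label skip
  | push {k a} : Label (push k a)
  | seqLeft {P Q} : Label P → Label (seq P Q)
  | seqRight {P Q} : Label Q → Label (seq P Q)
  | ifPop {k N F T} : Label (ifPop k N F T)
  | ifPopNone {k N F T} : Label N → Label (ifPop k N F T)
  | ifPopBit {k N F T} (a : Bool) : Label (cond a T F) → Label (ifPop k N F T)
  | loop {k F T} : Label (loop k F T)
  | loopBit {k F T} (a : Bool) : Label (cond a T F) → Label (loop k F T)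

theorem finite_label (P : StackProg) : Finite (Label P) := by
  induction P with
  | skip =>
    exact Finite.of_surjective (fun _ : Unit => Label.skip) (fun l => by cases l; exact ⟨(), rfl⟩)
  | push k a =>
    exact Finite.of_surjective (fun _ : Unit => Label.push) (fun l => by cases l; exact ⟨(), rfl⟩)
  | seq P Q hP hQ =>
    refine Finite.of_surjective (Sum.elim (Label.seqLeft (P := P) (Q := Q)) Label.seqRight) ?_
    rintro (_ | _ | l | l)
    exacts [⟨Sum.inl l, rfl⟩, ⟨Sum.inr l, rfl⟩]
  | ifPop k N F T hN hF hT =>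
    refine Finite.of_surjective (α := Option (Label N ⊕ Label F ⊕ Label T))
      (fun o => o.elim Label.ifPop (Sum.elim Label.ifPopNone
        (Sum.elim (Label.ifPopBit false) (Label.ifPopBit true)))) ?_
    intro l
    cases l with
    | ifPop => exact ⟨none, rfl⟩
    | ifPopNone l => exact ⟨some (Sum.inl l), rfl⟩
    | ifPopBit a l =>
      cases a
      exacts [⟨some (Sum.inr (Sum.inl l)), rfl⟩, ⟨some (Sum.inr (Sum.inr l)), rfl⟩]
  | loop k F T hF hT =>
    refine Finite.of_surjective (α := Option (Label F ⊕ Label T))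
      (fun o => o.elim Label.loop (Sum.elim (Label.loopBit false) (Label.loopBit true))) ?_
    intro l
    cases l with
    | loop => exact ⟨none, rfl⟩
    | loopBit a l =>
      cases a
      exacts [⟨some (Sum.inl l), rfl⟩, ⟨some (Sum.inr l), rfl⟩]

/-- The label at which a program starts. -/
def entry : (P : StackProg) → Label P
  | .skip => .skip
  | .push _ _ => .push
  | .seq P _ => .seqLeft P.entry
  | .ifPop _ _ _ _ => .ifPop
  | .loop _ _ _ => .loop

end StackProg

/-! ### Computations with an exact step count -/

namespace Turing

/-- `f` leads from `a` to `b` in exactly `t` steps. -/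
def StepsTo {σ : Type*} (f : σ → Option σ) (t : ℕ) (a b : σ) : Prop :=
  (flip bind f)^[t] (some a) = some b

namespace StepsTo

variable {σ τ : Type*} {f : σ → Option σ}

theorem refl (a : σ) : StepsTo f 0 a a := rfl

theorem single {a b : σ} (h : f a = some b) : StepsTo f 1 a b := h

theorem trans {t t' : ℕ} {a b c : σ} (h : StepsTo f t a b) (h' : StepsTo f t' b c) :
    StepsTo f (t + t') a c := by
  unfold StepsTo at *
  rw [add_comm, Function.iterate_add_apply, h, h']

theorem iterate_none (f : σ → Option σ) (t : ℕ) : (flip bind f)^[t] none = none := by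
  induction t with
  | zero => rfl
  | succ t ih => exact ih

/-- Transport of a computation along a simulation. -/
theorem simulate {g : τ → Option τ} (φ : σ → τ) (h : ∀ a b, f a = some b → g (φ a) = some (φ b))
    {t : ℕ} : ∀ {a b : σ}, StepsTo f t a b → StepsTo g t (φ a) (φ b) := by
  induction t with
  | zero =>
    intro a b hab
    cases (Option.some.inj hab)
    rfl
  | succ t ih =>
    intro a b hab
    unfold StepsTo at hab
    rw [Function.iterate_succ_apply] at hab
    change (flip bind f)^[t] (f a) = some b at hab
    cases ha : f a with
    | none => rw [ha, iterate_none] at hab; cases hab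
    | some c =>
      rw [ha] at hab
      rw [Nat.add_comm]
      exact (single (h a c ha)).trans (ih hab)

end StepsTo

end Turing

namespace StackProg

open Turing

/-! The machine that runs a program, moves its output stack `1` onto the input stack of a machine
`M` and then runs `M`. -/

section Host

variable (m : ℕ) (M : TM2ComputableAux Bool Bool)

/-- The stack alphabets of the combined machine. -/
abbrev hostΓ : Fin (m + 2) ⊕ M.tm.K → Type
  | Sum.inl _ => Bool
  | Sum.inr k => M.tm.Γ k

/-- The internal states of the combined machine: a bit register and a state of `M`. -/
abbrev HostState : Type := Option Bool × M.tm.σ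

/-- The labels of the combined machine; `inl none` is the label of the transfer loop. -/
abbrev HostLabel (P : StackProg) : Type := Option (Label P) ⊕ M.tm.Λ

variable {m M}

/-- Pop stack `k` and continue at a label that depends on the result. -/
def popGoto {L : Type} (k : ℕ) (next : Option Bool → L) : TM2.Stmt (hostΓ m M) L (HostState M) :=
  .pop (Sum.inl (Fin.ofNat (m + 2) k)) (fun v o => (o, v.2))
    (.branch (fun v => v.1 == none) (.load (fun v => (none, v.2)) (.goto fun _ => next none))
      (.branch (fun v => v.1 == some true)
        (.load (fun v => (none, v.2)) (.goto fun _ => next (some true)))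
        (.load (fun v => (none, v.2)) (.goto fun _ => next (some false)))))

/-- The code of a program, with its labels embedded into `L` and leaving to the label `exit`. -/
def code {L : Type} : (P : StackProg) → (Label P → L) → L → Label P →
    TM2.Stmt (hostΓ m M) L (HostState M)
  | .skip, _, exit, _ => .goto fun _ => exit
  | .push k a, _, exit, _ =>
      .push (Sum.inl (Fin.ofNat (m + 2) k)) (fun _ => a) (.goto fun _ => exit)
  | .seq P Q, emb, _, .seqLeft l =>
      code P (fun l => emb (.seqLeft l)) (emb (.seqRight Q.entry)) l
  | .seq _ Q, emb, exit, .seqRight l => code Q (fun l => emb (.seqRight l)) exit l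
  | .ifPop k N F T, emb, _, .ifPop =>
      popGoto k fun o => o.elim (emb (.ifPopNone N.entry))
        fun a => emb (.ifPopBit a (entry (cond a T F)))
  | .ifPop _ N _ _, emb, exit, .ifPopNone l => code N (fun l => emb (.ifPopNone l)) exit l
  | .ifPop _ _ F _, emb, exit, .ifPopBit false l =>
      code F (fun l => emb (.ifPopBit false l)) exit l
  | .ifPop _ _ _ T, emb, exit, .ifPopBit true l => code T (fun l => emb (.ifPopBit true l)) exit l
  | .loop k F T, emb, exit, .loop =>
      popGoto k fun o => o.elim exit fun a => emb (.loopBit a (entry (cond a T F)))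
  | .loop _ F _, emb, _, .loopBit false l =>
      code F (fun l => emb (.loopBit false l)) (emb .loop) l
  | .loop _ _ T, emb, _, .loopBit true l => code T (fun l => emb (.loopBit true l)) (emb .loop) l

/-- The stacks of the combined machine. -/
def hostStk (s : ℕ → List Bool) (S : ∀ k, List (M.tm.Γ k)) : ∀ k, List (hostΓ m M k)
  | Sum.inl i => s i
  | Sum.inr k => S k

/-- Stack indices are reduced modulo `m + 2` to land in a finite type; below the bound no two of
them are identified. -/
theorem hostStk_inl {k : ℕ} (hk : k ≤ m + 1) (s : ℕ → List Bool) (S : ∀ k, List (M.tm.Γ k)) :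
    hostStk (m := m) s S (Sum.inl (Fin.ofNat (m + 2) k)) = s k := by
  change s (k % (m + 2)) = s k
  rw [Nat.mod_eq_of_lt (by omega)]

theorem update_hostStk_inl {k : ℕ} (hk : k ≤ m + 1) (s : ℕ → List Bool)
    (S : ∀ k, List (M.tm.Γ k)) (l : List Bool) :
    update (hostStk (m := m) s S) (Sum.inl (Fin.ofNat (m + 2) k)) l =
      hostStk (update s k l) S := by
  funext i
  rcases i with i | i
  · by_cases h : i = Fin.ofNat (m + 2) k
    · subst h
      rw [Function.update_self, hostStk_inl hk, Function.update_self]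
    · rw [Function.update_of_ne (fun hh => h (Sum.inl.inj hh))]
      have : (i : ℕ) ≠ k := by
        rintro rfl
        exact h (by ext; simp)
      simp [hostStk, this]
  · rw [Function.update_of_ne (by simp)]
    rfl

/-- The bit register is cleared before each jump, so `none` in the register is an invariant at every
label and the whole test takes one machine step. -/
theorem step_popGoto {L : Type} {c : L → TM2.Stmt (hostΓ m M) L (HostState M)} {l : L} {k : ℕ}
    {next : Option Bool → L} (hl : c l = popGoto k next) (hk : k ≤ m + 1) (s : ℕ → List Bool)
    (S : ∀ k, List (M.tm.Γ k)) (v : M.tm.σ) :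
    TM2.step c ⟨some l, (none, v), hostStk s S⟩ =
      some ⟨some (next (s k).head?), (none, v), hostStk (update s k (s k).tail) S⟩ := by
  rw [TM2.step, hl, popGoto, TM2.stepAux, hostStk_inl hk, update_hostStk_inl hk]
  cases s k with
  | nil => rfl
  | cons a t => cases a <;> rfl

/-- Correctness of the compilation. -/
theorem Exec.stepsTo {P : StackProg} {s s' : ℕ → List Bool} {t : ℕ} (h : Exec P s t s') :
    ∀ {L : Type} (c : L → TM2.Stmt (hostΓ m M) L (HostState M)) (emb : Label P → L) (exit : L),
    (∀ l, c (emb l) = code P emb exit l) → P.maxStack ≤ m + 1 →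
    ∀ (S : ∀ k, List (M.tm.Γ k)) (v : M.tm.σ), ∃ t' ≤ t,
      StepsTo (TM2.step c) t' ⟨some (emb P.entry), (none, v), hostStk s S⟩
        ⟨some exit, (none, v), hostStk s' S⟩ := by
  -- The ambient label type, its code, the embedding and the exit stay universally quantified, since
  -- a subprogram is entered with another embedding and another exit.
  induction h with
  | skip s =>
    intro L c emb exit hc hm S v
    refine ⟨1, le_rfl, .single ?_⟩
    rw [TM2.step, hc]
    rfl
  | push k a s =>
    intro L c emb exit hc hm S v
    replace hm : k ≤ m + 1 := hm
    refine ⟨1, le_rfl, .single ?_⟩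
    rw [TM2.step, hc]
    change some (TM2.Cfg.mk _ _ (update _ _ (a :: hostStk (m := m) s S
      (Sum.inl (Fin.ofNat (m + 2) k))))) = _
    rw [hostStk_inl hm, update_hostStk_inl hm]
  | @seq P Q s t s' t' s'' _ _ ihP ihQ =>
    intro L c emb exit hc hm S v
    simp only [maxStack, max_le_iff] at hm
    obtain ⟨t₁, ht₁, h₁⟩ := ihP c (fun l => emb (.seqLeft l)) (emb (.seqRight Q.entry))
      (fun l => by rw [hc, code]) hm.1 S v
    obtain ⟨t₂, ht₂, h₂⟩ := ihQ c (fun l => emb (.seqRight l)) exit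
      (fun l => by rw [hc, code]) hm.2 S v
    exact ⟨t₁ + t₂, add_le_add ht₁ ht₂, h₁.trans h₂⟩
  | @ifPop_nil k N F T s t s' hk _ ih =>
    intro L c emb exit hc hm S v
    simp only [maxStack, max_le_iff] at hm
    obtain ⟨t₁, ht₁, h₁⟩ := ih c (fun l => emb (.ifPopNone l)) exit
      (fun l => by rw [hc, code]) hm.2.1 S v
    have h₀ := step_popGoto (c := c) (l := emb .ifPop) (by rw [hc, code]) hm.1 s S v
    rw [hk] at h₀
    simp only [List.head?_nil, List.tail_nil] at h₀
    -- Popping an empty stack leaves all stacks as they were.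
    rw [← hk, Function.update_eq_self] at h₀
    refine ⟨1 + t₁, by omega, (StepsTo.single h₀).trans h₁⟩
  | @ifPop_cons k N F T s t s' a l hk _ ih =>
    intro L c emb exit hc hm S v
    simp only [maxStack, max_le_iff] at hm
    obtain ⟨t₁, ht₁, h₁⟩ := ih c (fun l => emb (.ifPopBit a l)) exit
      (fun l => by cases a <;> rw [hc, code] <;> rfl)
      (by cases a; exacts [hm.2.2.1, hm.2.2.2]) S v
    have h₀ := step_popGoto (c := c) (l := emb .ifPop) (by rw [hc, code]) hm.1 s S v
    rw [hk] at h₀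
    exact ⟨1 + t₁, by omega, (StepsTo.single h₀).trans h₁⟩
  | @loop_nil k F T s hk =>
    intro L c emb exit hc hm S v
    simp only [maxStack, max_le_iff] at hm
    have h₀ := step_popGoto (c := c) (l := emb .loop) (by rw [hc, code]) hm.1 s S v
    rw [hk] at h₀
    simp only [List.head?_nil, List.tail_nil] at h₀
    rw [← hk, Function.update_eq_self] at h₀
    exact ⟨1, le_rfl, .single h₀⟩
  | @loop_cons k F T s t s' t' s'' a l hk _ _ ih ih' =>
    intro L c emb exit hc hm S v
    obtain ⟨t₂, ht₂, h₂⟩ := ih' c emb exit hc hm S v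
    simp only [maxStack, max_le_iff] at hm
    obtain ⟨t₁, ht₁, h₁⟩ := ih c (fun l => emb (.loopBit a l)) (emb .loop)
      (fun l => by cases a <;> rw [hc, code] <;> rfl)
      (by cases a; exacts [hm.2.1, hm.2.2]) S v
    have h₀ := step_popGoto (c := c) (l := emb .loop) (by rw [hc, code]) hm.1 s S v
    rw [hk] at h₀
    exact ⟨1 + t₁ + t₂, by omega, ((StepsTo.single h₀).trans h₁).trans h₂⟩
  | mono _ hle ih =>
    intro L c emb exit hc hm S v
    obtain ⟨t₁, ht₁, h₁⟩ := ih c emb exit hc hm S v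
    exact ⟨t₁, ht₁.trans hle, h₁⟩

/-- The statements of `M` inside the combined machine. -/
def embedStmt {L : Type} (emb : M.tm.Λ → L) :
    TM2.Stmt M.tm.Γ M.tm.Λ M.tm.σ → TM2.Stmt (hostΓ m M) L (HostState M)
  | .push k f q => .push (Sum.inr k) (fun v => f v.2) (embedStmt emb q)
  | .peek k f q => .peek (Sum.inr k) (fun v o => (v.1, f v.2 o)) (embedStmt emb q)
  | .pop k f q => .pop (Sum.inr k) (fun v o => (v.1, f v.2 o)) (embedStmt emb q)
  | .load f q => .load (fun v => (v.1, f v.2)) (embedStmt emb q)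
  | .branch f q₁ q₂ => .branch (fun v => f v.2) (embedStmt emb q₁) (embedStmt emb q₂)
  | .goto f => .goto fun v => emb (f v.2)
  | .halt => .halt

/-- The configurations of `M` inside the combined machine. -/
def embedCfg {L : Type} (emb : M.tm.Λ → L) (C : TM2.Cfg M.tm.Γ M.tm.Λ M.tm.σ) :
    TM2.Cfg (hostΓ m M) L (HostState M) :=
  ⟨C.l.map emb, (none, C.var), hostStk (fun _ => []) C.stk⟩

theorem update_hostStk_inr (s : ℕ → List Bool) (S : ∀ k, List (M.tm.Γ k)) (k : M.tm.K)
    (l : List (M.tm.Γ k)) :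
    update (hostStk (m := m) s S) (Sum.inr k) l = hostStk s (update S k l) := by
  funext i
  rcases i with i | i
  · rw [Function.update_of_ne (by simp)]
    rfl
  · by_cases h : i = k
    · subst h
      rw [Function.update_self]
      exact (Function.update_self (β := fun k => List (M.tm.Γ k)) ..).symm
    · rw [Function.update_of_ne (fun hh => h (Sum.inr.inj hh))]
      exact (Function.update_of_ne (β := fun k => List (M.tm.Γ k)) h ..).symm

/-- While `M` runs, the bit register stays `none` and the program stacks stay empty, so the
embedding of configurations commutes with each statement. -/
theorem stepAux_embedStmt {L : Type} (emb : M.tm.Λ → L) (q : TM2.Stmt M.tm.Γ M.tm.Λ M.tm.σ) :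
    ∀ (v : M.tm.σ) (S : ∀ k, List (M.tm.Γ k)),
      TM2.stepAux (embedStmt (m := m) emb q) (none, v) (hostStk (fun _ => []) S) =
        embedCfg emb (TM2.stepAux q v S) := by
  induction q with
  | push k f q ih =>
    intro v S
    rw [embedStmt, TM2.stepAux, TM2.stepAux, update_hostStk_inr]
    exact ih _ _
  | peek k f q ih => intro v S; exact ih _ _
  | pop k f q ih =>
    intro v S
    rw [embedStmt, TM2.stepAux, TM2.stepAux, update_hostStk_inr]
    exact ih _ _
  | load f q ih => intro v S; exact ih _ _
  | branch f q₁ q₂ ih₁ ih₂ =>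
    intro v S
    rw [embedStmt, TM2.stepAux, TM2.stepAux]
    cases f v
    exacts [ih₂ v S, ih₁ v S]
  | goto f => intro v S; rfl
  | halt => intro v S; rfl

variable (m M) in
/-- The code of the combined machine. -/
def hostCode (P : StackProg) :
    HostLabel M P → TM2.Stmt (hostΓ m M) (HostLabel M P) (HostState M)
  | Sum.inl (some l) => code P (fun l => Sum.inl (some l)) (Sum.inl none) l
  | Sum.inl none =>
      .pop (Sum.inl (Fin.ofNat (m + 2) 1)) (fun v o => (o, v.2))
        (.branch (fun v => v.1 == none) (.goto fun _ => Sum.inr M.tm.main)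
          (.push (Sum.inr M.tm.k₀) (fun v => M.inputAlphabet.symm (v.1.getD false))
            (.load (fun v => (none, v.2)) (.goto fun _ => Sum.inl none))))
  | Sum.inr l => embedStmt Sum.inr (M.tm.m l)

variable (m M) in
/-- The combined machine. -/
noncomputable def host (P : StackProg) : TM2ComputableAux Bool Bool where
  tm :=
    { K := Fin (m + 2) ⊕ M.tm.K
      kDecidableEq := @instDecidableEqSum _ _ _ M.tm.kDecidableEq
      kFin := @instFintypeSum _ _ _ M.tm.kFin
      k₀ := Sum.inl 0
      k₁ := Sum.inr M.tm.k₁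
      Γ := hostΓ m M
      Λ := HostLabel M P
      main := Sum.inl (some P.entry)
      ΛFin := by
        haveI := finite_label P
        haveI := M.tm.ΛFin
        exact Fintype.ofFinite _
      σ := HostState M
      initialState := (none, M.tm.initialState)
      σFin := by
        haveI := M.tm.σFin
        exact inferInstance
      Γk₀Fin := inferInstanceAs (Fintype Bool)
      m := hostCode m M P }
  inputAlphabet := Equiv.refl Bool
  outputAlphabet := M.outputAlphabet

/-- The transfer reverses the word. Programs leave their output reversed on stack `1`, so `M`
receives it in the right order. The extra step is the pop that finds the stack empty. -/
theorem transfer_stepsTo (P : StackProg) (v : M.tm.σ) (l : List Bool) :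
    ∀ S : ∀ k, List (M.tm.Γ k),
    StepsTo (TM2.step (hostCode m M P)) (l.length + 1)
      ⟨some (Sum.inl none), (none, v), hostStk (update (fun _ => []) 1 l) S⟩
      ⟨some (Sum.inr M.tm.main), (none, v), hostStk (fun _ => [])
        (update S M.tm.k₀ ((l.map M.inputAlphabet.symm).reverse ++ S M.tm.k₀))⟩ := by
  induction l with
  | nil =>
    intro S
    refine .single ?_
    rw [TM2.step, hostCode, TM2.stepAux, hostStk_inl (by omega), update_hostStk_inl (by omega)]
    simp
  | cons a l ih =>
    intro S
    rw [List.length_cons, Nat.add_comm (l.length + 1)]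
    have h := ih (update S M.tm.k₀ (M.inputAlphabet.symm a :: S M.tm.k₀))
    rw [Function.update_self, Function.update_idem] at h
    rw [List.map_cons, List.reverse_cons, List.append_assoc, List.singleton_append]
    refine StepsTo.trans (.single ?_) h
    rw [TM2.step, hostCode, TM2.stepAux, hostStk_inl (by omega), update_hostStk_inl (by omega)]
    simp only [Function.update_self, Function.update_idem, List.head?_cons, List.tail_cons]
    rw [TM2.stepAux]
    simp only [TM2.stepAux, Option.getD_some, update_hostStk_inr]
    rfl

theorem initList_stk (tm : FinTM2) (l : List (tm.Γ tm.k₀)) :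
    (initList tm l).stk = update (fun _ => []) tm.k₀ l := by
  funext k
  by_cases h : k = tm.k₀
  · subst h
    simp [initList]
  · simp [initList, h]

theorem haltList_stk (tm : FinTM2) (l : List (tm.Γ tm.k₁)) :
    (haltList tm l).stk = update (fun _ => []) tm.k₁ l := by
  funext k
  by_cases h : k = tm.k₁
  · subst h
    simp [haltList]
  · simp [haltList, h]

/-- The combined machine outputs what `M` outputs on the reversed output of the program. -/
theorem host_outputs {P : StackProg} (hP : P.maxStack ≤ m + 1) {x y : List Bool} {t : ℕ}
    (h : Exec P (update (fun _ => []) 0 x) t (update (fun _ => []) 1 y.reverse))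
    {z : List (M.tm.Γ M.tm.k₁)} {t' : ℕ}
    (hM : Nonempty (TM2OutputsInTime M.tm (y.map M.inputAlphabet.symm) (some z) t')) :
    Nonempty (TM2OutputsInTime (host m M P).tm x (some z) (t + (y.length + 1) + t')) := by
  obtain ⟨⟨⟨t₂, h₂⟩, ht₂⟩⟩ := hM
  obtain ⟨t₁, ht₁, h₁⟩ := h.stepsTo (hostCode m M P) (fun l => Sum.inl (some l)) (Sum.inl none)
    (fun l => rfl) hP (fun _ => []) M.tm.initialState
  have h₃ := transfer_stepsTo (m := m) (M := M) P M.tm.initialState y.reverse (fun _ => [])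
  have h₄ : StepsTo (TM2.step (hostCode m M P)) t₂
      (embedCfg Sum.inr (initList M.tm (y.map M.inputAlphabet.symm)))
      (embedCfg Sum.inr (haltList M.tm z)) := by
    -- The run of `M` is replayed step by step inside the combined machine.
    refine StepsTo.simulate (f := TM2.step M.tm.m) (embedCfg Sum.inr) ?_ h₂
    rintro ⟨l, v, S⟩ b hb
    cases l with
    | none => cases hb
    | some l =>
      rw [TM2.step] at hb
      rw [← Option.some.inj hb]
      exact congrArg some (stepAux_embedStmt Sum.inr _ v S)
  have e : (fun _ => [] : ∀ k, List (hostΓ m M k)) = hostStk (fun _ => []) (fun _ => []) := by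
    funext k
    cases k <;> rfl
  have e₁ : initList (host m M P).tm x =
      (⟨some (Sum.inl (some P.entry)), (none, M.tm.initialState),
        hostStk (update (fun _ => []) 0 x) (fun _ => [])⟩ :
        TM2.Cfg (hostΓ m M) (HostLabel M P) (HostState M)) := by
    refine congrArg (TM2.Cfg.mk (some (Sum.inl (some P.entry))) (none, M.tm.initialState))
      ((initList_stk (host m M P).tm x).trans ?_)
    refine Eq.trans ?_ (update_hostStk_inl (m := m) (M := M) (k := 0) (by omega) _ _ _)
    rw [← e]
    rfl
  have e₂ : haltList (host m M P).tm z =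
      (embedCfg Sum.inr (haltList M.tm z) :
        TM2.Cfg (hostΓ m M) (HostLabel M P) (HostState M)) := by
    refine congrArg (TM2.Cfg.mk none (none, M.tm.initialState))
      ((haltList_stk (host m M P).tm z).trans ?_)
    refine Eq.trans ?_ (congrArg (hostStk (fun _ => [])) (haltList_stk M.tm z)).symm
    refine Eq.trans ?_ (update_hostStk_inr (m := m) (M := M) _ _ _ _)
    rw [← e]
    rfl
  have e₃ : (embedCfg Sum.inr (initList M.tm (y.map M.inputAlphabet.symm)) :
        TM2.Cfg (hostΓ m M) (HostLabel M P) (HostState M)) =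
      ⟨some (Sum.inr M.tm.main), (none, M.tm.initialState), hostStk (fun _ => [])
        (update (fun _ => []) M.tm.k₀ ((y.reverse.map M.inputAlphabet.symm).reverse ++ []))⟩ := by
    refine congrArg (fun S => TM2.Cfg.mk (some (Sum.inr M.tm.main)) (none, M.tm.initialState)
      (hostStk (fun _ => []) S)) ((initList_stk M.tm _).trans ?_)
    rw [List.append_nil, List.map_reverse, List.reverse_reverse]
  rw [e₃] at h₄
  have h₅ := (h₁.trans h₃).trans h₄
  rw [List.length_reverse] at h₅
  refine ⟨⟨⟨t₁ + (y.length + 1) + t₂, ?_⟩, ?_⟩⟩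
  · refine Eq.trans ?_ (Eq.trans h₅ (congrArg some e₂.symm))
    exact congrArg _ (congrArg some e₁)
  · change t₁ + (y.length + 1) + t₂ ≤ _
    have : t₂ ≤ t' := ht₂
    omega

end Host

end StackProg

theorem Polynomial.eval_mono_nat (q : Polynomial ℕ) {a b : ℕ} (h : a ≤ b) :
    q.eval a ≤ q.eval b := by
  rw [Polynomial.eval_eq_sum, Polynomial.eval_eq_sum]
  exact Finset.sum_le_sum fun i _ => Nat.mul_le_mul_left _ (Nat.pow_le_pow_left h i)

namespace StackProg

/-- The unary representation of a number on a stack. -/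
abbrev num (n : ℕ) : List Bool := List.replicate n true

/-! ### Basic programs -/

/-- Move the contents of stack `a` onto stack `b`, reversing it. -/
def move (a b : ℕ) : StackProg := loop a (push b false) (push b true)

theorem exec_move {a b : ℕ} (hab : a ≠ b) (l : List Bool) : ∀ s : ℕ → List Bool, s a = l →
    Exec (move a b) s (2 * l.length + 1) (update (update s a []) b (l.reverse ++ s b)) := by
  induction l with
  | nil =>
    intro s hs
    refine (Exec.loop_nil hs).congr (by simp) ?_
    funext j
    simp only [Function.update_apply]
    split_ifs <;> simp_all
  | cons c l ih =>
    intro s hs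
    have h := ih (update (update s a l) b (c :: s b)) (by simp [hab])
    refine (Exec.loop_cons (t := 1) hs ?_ h).congr (by simp; omega) ?_
    · cases c <;> refine (Exec.push _ _ _).congr le_rfl ?_ <;> simp [hab.symm]
    · funext j
      simp only [Function.update_apply]
      split_ifs <;> simp_all

/-- Empty stack `a`. -/
def clear (a : ℕ) : StackProg := loop a skip skip

theorem exec_clear {a : ℕ} (l : List Bool) : ∀ s : ℕ → List Bool, s a = l →
    Exec (clear a) s (2 * l.length + 1) (update s a []) := by
  induction l with
  | nil =>
    intro s hs
    exact (Exec.loop_nil hs).congr (by simp) (by rw [← hs, Function.update_eq_self])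
  | cons c l ih =>
    intro s hs
    have h := ih (update s a l) (by simp)
    refine (Exec.loop_cons (t := 1) (s' := update s a l) hs ?_ h).congr (by simp; omega) (by simp)
    cases c <;> exact Exec.skip _

/-- Push the length of stack `a`, in unary, onto stack `b`, using the empty stack `c`. -/
def copyLen (a b c : ℕ) : StackProg :=
  seq (loop a (seq (push c false) (push b true)) (seq (push c true) (push b true))) (move c a)

theorem exec_copyLen_loop {a b c : ℕ} (hab : a ≠ b) (hac : a ≠ c) (hbc : b ≠ c) (l : List Bool) :
    ∀ s : ℕ → List Bool, s a = l →
    Exec (loop a (seq (push c false) (push b true)) (seq (push c true) (push b true))) s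
      (3 * l.length + 1)
      (update (update (update s a []) b (num l.length ++ s b)) c (l.reverse ++ s c)) := by
  induction l with
  | nil =>
    intro s hs
    refine (Exec.loop_nil hs).congr (by simp) ?_
    funext j
    simp only [Function.update_apply]
    split_ifs <;> simp_all
  | cons x l ih =>
    intro s hs
    have h := ih (update (update (update s a l) c (x :: s c)) b (true :: s b)) (by simp [hab, hac])
    refine (Exec.loop_cons (t := 2) hs ?_ h).congr (by simp; omega) ?_
    · cases x <;> refine ((Exec.push _ _ _).seq (Exec.push _ _ _)).congr le_rfl ?_ <;>
        simp [hac.symm, hab.symm, hbc]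
    · funext j
      simp only [Function.update_apply]
      split_ifs <;> simp_all [List.replicate_succ']

/-- Stack `a` is emptied into `c` while one `true` per bit goes onto `b`; moving `c` back undoes the
reversal and restores `a`. -/
theorem exec_copyLen {a b c : ℕ} (hab : a ≠ b) (hac : a ≠ c) (hbc : b ≠ c) {s : ℕ → List Bool}
    (hc : s c = []) :
    Exec (copyLen a b c) s (5 * (s a).length + 2) (update s b (num (s a).length ++ s b)) := by
  refine ((exec_copyLen_loop hab hac hbc _ s rfl).seq
    (exec_move hac.symm _ _ rfl)).congr ?_ ?_
  · simp [hc]; omega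
  · funext j
    simp only [Function.update_apply]
    split_ifs <;> simp_all

/-- The invariant rule for counting loops: `st i` is the state before pass `i`, with `n - i` left on
the counter. A unary number has no `false` bits, so only the branch `T` is ever taken. -/
theorem exec_loop_num {k : ℕ} {F T : StackProg} {c : ℕ} (n : ℕ) : ∀ st : ℕ → ℕ → List Bool,
    (∀ i ≤ n, st i k = num (n - i)) →
    (∀ i < n, Exec T (update (st i) k (num (n - i - 1))) c (st (i + 1))) →
    Exec (loop k F T) (st 0) (n * (c + 1) + 1) (st n) := by
  induction n with
  | zero =>
    intro st hk _
    exact (Exec.loop_nil (by simpa using hk 0 le_rfl)).congr (by simp) rfl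
  | succ n ih =>
    intro st hk hT
    have h := ih (fun i => st (i + 1))
      (fun i hi => by rw [hk (i + 1) (by omega)]; congr 1; omega)
      (fun i hi => by
        have := hT (i + 1) (by omega)
        rwa [show n + 1 - (i + 1) - 1 = n - i - 1 by omega] at this)
    have h0 := hT 0 (by omega)
    refine (Exec.loop_cons (t := c) (a := true) (l := num n) ?_ ?_ h).congr ?_ rfl
    · rw [hk 0 (by omega)]; rfl
    · simpa using h0
    · ring_nf; omega

/-! ### Functions computed in polynomial time on unary numbers -/

/-- The stacks `s` hold the input `x` on stack `0` and the numbers `ρ i` on the stacks `r i`; the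
stacks from `d` on are empty. Stack `1` is reserved for the output. -/
structure Ready {n : ℕ} (x : List Bool) (ρ r : Fin n → ℕ) (d : ℕ) (s : ℕ → List Bool) : Prop where
  two_le : 2 ≤ d
  two_le_reg : ∀ i, 2 ≤ r i
  reg_lt : ∀ i, r i < d
  input : s 0 = x
  reg : ∀ i, s (r i) = num (ρ i)
  free : ∀ j, d ≤ j → s j = []

namespace Ready

variable {n : ℕ} {x : List Bool} {ρ r : Fin n → ℕ} {d : ℕ} {s : ℕ → List Bool}

theorem update (h : Ready x ρ r d s) (l : List Bool) : Ready x ρ r (d + 1) (update s d l) where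
  two_le := by have := h.two_le; omega
  two_le_reg := h.two_le_reg
  reg_lt i := by have := h.reg_lt i; omega
  input := by
    have := h.two_le
    rw [Function.update_of_ne (by omega), h.input]
  reg i := by
    have := h.reg_lt i
    rw [Function.update_of_ne (by omega), h.reg]
  free j hj := by rw [Function.update_of_ne (by omega), h.free j (by omega)]

theorem output (h : Ready x ρ r d s) (l : List Bool) : Ready x ρ r d (Function.update s 1 l) where
  two_le := h.two_le
  two_le_reg := h.two_le_reg
  reg_lt := h.reg_lt
  input := by rw [Function.update_of_ne (by omega), h.input]
  reg i := by
    have := h.two_le_reg i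
    rw [Function.update_of_ne (by omega), h.reg]
  free j hj := by
    have := h.two_le
    rw [Function.update_of_ne (by omega), h.free j hj]

/-- The value just computed on stack `d` becomes the variable with index `0`, and the older
variables shift by one. -/
theorem bind (h : Ready x ρ r (d + 1) s) (hd : 2 ≤ d) {a : ℕ} (hs : s d = num a) :
    Ready x (Fin.cons a ρ : Fin (n + 1) → ℕ) (Fin.cons d r : Fin (n + 1) → ℕ) (d + 1) s where
  two_le := h.two_le
  two_le_reg i := by
    induction i using Fin.cases with
    | zero => exact hd
    | succ i => exact h.two_le_reg i
  reg_lt i := by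
    induction i using Fin.cases with
    | zero => exact Nat.lt_succ_self d
    | succ i => exact h.reg_lt i
  input := h.input
  reg i := by
    induction i using Fin.cases with
    | zero => exact hs
    | succ i => exact h.reg i
  free := h.free

theorem mono (h : Ready x ρ r d s) {d' : ℕ} (hd : d ≤ d') : Ready x ρ r d' s where
  two_le := h.two_le.trans hd
  two_le_reg := h.two_le_reg
  reg_lt i := (h.reg_lt i).trans_le hd
  input := h.input
  reg := h.reg
  free j hj := h.free j (hd.trans hj)

end Ready

/-- `F x ρ` is computed, in unary, in time polynomial in the length of `x` and in the numbers
`ρ i`. -/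
def PolyFn {n : ℕ} (F : List Bool → (Fin n → ℕ) → ℕ) : Prop :=
  ∃ (P : (Fin n → ℕ) → ℕ → StackProg) (q : Polynomial ℕ), ∀ x ρ B, x.length ≤ B → (∀ i, ρ i ≤ B) →
    F x ρ ≤ q.eval B ∧ ∀ r d s, Ready x ρ r d s →
      Exec (P r d) s (q.eval B) (update s d (num (F x ρ)))

namespace PolyFn

variable {n : ℕ} {F G : List Bool → (Fin n → ℕ) → ℕ}

theorem of_eq (hF : PolyFn F) (h : ∀ x ρ, F x ρ = G x ρ) : PolyFn G := by
  have : F = G := funext fun x => funext (h x)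
  exact this ▸ hF

/-- `Ready` does not require the registers to be distinct, so variables can be duplicated, permuted
or dropped by renaming registers, at no cost. -/
theorem reindex {m : ℕ} (hF : PolyFn F) (π : Fin n → Fin m) :
    PolyFn fun x (ρ : Fin m → ℕ) => F x (fun i => ρ (π i)) := by
  obtain ⟨P, q, h⟩ := hF
  refine ⟨fun r d => P (fun i => r (π i)) d, q, fun x ρ B hx hρ => ?_⟩
  obtain ⟨h₁, h₂⟩ := h x (fun i => ρ (π i)) B hx (fun i => hρ _)
  exact ⟨h₁, fun r d s hs => h₂ _ d s
    ⟨hs.two_le, fun i => hs.two_le_reg _, fun i => hs.reg_lt _, hs.input, fun i => hs.reg _,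
      hs.free⟩⟩

theorem proj (i : Fin n) : PolyFn fun _ ρ => ρ i := by
  refine ⟨fun r d => copyLen (r i) d (d + 1), 5 * Polynomial.X + 2, fun x ρ B hx hρ => ?_⟩
  have hi := hρ i
  simp only [Polynomial.eval_add, Polynomial.eval_mul, Polynomial.eval_X, Polynomial.eval_ofNat]
  refine ⟨by omega, fun r d s hs => ?_⟩
  have := hs.reg_lt i
  refine (exec_copyLen (by omega) (by omega) (by omega) (hs.free _ (by omega))).congr ?_ ?_
  · rw [hs.reg, List.length_replicate]; omega
  · rw [hs.reg, hs.free d le_rfl, List.length_replicate, List.append_nil]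

theorem length : PolyFn fun x (_ : Fin n → ℕ) => x.length := by
  refine ⟨fun r d => copyLen 0 d (d + 1), 5 * Polynomial.X + 2, fun x ρ B hx hρ => ?_⟩
  simp only [Polynomial.eval_add, Polynomial.eval_mul, Polynomial.eval_X, Polynomial.eval_ofNat]
  refine ⟨by omega, fun r d s hs => ?_⟩
  have := hs.two_le
  refine (exec_copyLen (by omega) (by omega) (by omega) (hs.free _ (by omega))).congr ?_ ?_
  · rw [hs.input]; omega
  · rw [hs.input, hs.free d le_rfl, List.append_nil]

theorem const (c : ℕ) : PolyFn fun _ (_ : Fin n → ℕ) => c := by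
  induction c with
  | zero =>
    refine ⟨fun r d => skip, 1, fun x ρ B hx hρ => ⟨Nat.zero_le _, fun r d s hs => ?_⟩⟩
    refine (Exec.skip s).congr (by simp) ?_
    rw [num, List.replicate_zero, ← hs.free d le_rfl, Function.update_eq_self]
  | succ c ih =>
    obtain ⟨P, q, h⟩ := ih
    refine ⟨fun r d => seq (P r d) (push d true), q + 1, fun x ρ B hx hρ => ?_⟩
    obtain ⟨h₁, h₂⟩ := h x ρ B hx hρ
    replace h₁ : c ≤ q.eval B := h₁
    simp only [Polynomial.eval_add, Polynomial.eval_one]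
    refine ⟨by omega, fun r d s hs => ?_⟩
    refine ((h₂ r d s hs).seq (Exec.push _ _ _)).congr le_rfl ?_
    simp [List.replicate_succ]

theorem add (hF : PolyFn F) (hG : PolyFn G) : PolyFn fun x ρ => F x ρ + G x ρ := by
  obtain ⟨P, p, hP⟩ := hF
  obtain ⟨Q, q, hQ⟩ := hG
  refine ⟨fun r d => seq (P r d) (seq (Q r (d + 1)) (move (d + 1) d)), p + (q + (2 * q + 1)),
    fun x ρ B hx hρ => ?_⟩
  obtain ⟨hp, hP⟩ := hP x ρ B hx hρ
  obtain ⟨hq, hQ⟩ := hQ x ρ B hx hρ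
  simp only [Polynomial.eval_add, Polynomial.eval_one, Polynomial.eval_mul, Polynomial.eval_ofNat]
  refine ⟨by omega, fun r d s hs => ?_⟩
  have h₁ := hs.free (d + 1) (by omega)
  refine ((hP r d s hs).seq ((hQ r (d + 1) _ (hs.update _)).seq
    (exec_move (by omega) (num (G x ρ)) _ (by simp)))).congr ?_ ?_
  · rw [List.length_replicate]; omega
  · funext j
    by_cases h₂ : j = d
    · subst h₂
      simp [Nat.add_comm]
    · by_cases h₃ : j = d + 1
      · subst h₃
        simp [h₁]
      · simp [h₂, h₃]

/-- Each unit of `b` removes a unit of `a` if one is left; popping the empty stack is harmless,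
which yields truncated subtraction. -/
theorem exec_sub {d : ℕ} {s : ℕ → List Bool} (a b : ℕ) :
    Exec (loop (d + 1) skip (ifPop d skip skip skip))
      (update (update s d (num a)) (d + 1) (num b)) (b * 3 + 1)
      (update (update s d (num (a - b))) (d + 1) []) := by
  have h := exec_loop_num (k := d + 1) (F := skip) (T := ifPop d skip skip skip) (c := 2) b
    (fun i => update (update s d (num (a - i))) (d + 1) (num (b - i))) (fun i _ => by simp) ?_
  · simpa using h
  · intro i hi
    rw [Function.update_idem]
    cases hc : a - i with
    | zero =>
      refine (Exec.ifPop_nil (by simp) (Exec.skip _)).congr le_rfl ?_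
      rw [show a - (i + 1) = 0 by omega, show b - (i + 1) = b - i - 1 by omega]
    | succ c =>
      refine (Exec.ifPop_cons (a := true) (l := num c) (by simp [List.replicate_succ])
        (Exec.skip _)).congr le_rfl ?_
      rw [show a - (i + 1) = c by omega, show b - (i + 1) = b - i - 1 by omega]
      funext j
      simp only [Function.update_apply]
      split_ifs <;> first | rfl | omega

theorem sub (hF : PolyFn F) (hG : PolyFn G) : PolyFn fun x ρ => F x ρ - G x ρ := by
  obtain ⟨P, p, hP⟩ := hF
  obtain ⟨Q, q, hQ⟩ := hG
  refine ⟨fun r d => seq (P r d) (seq (Q r (d + 1)) (loop (d + 1) skip (ifPop d skip skip skip))),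
    p + (q + (q * 3 + 1)), fun x ρ B hx hρ => ?_⟩
  obtain ⟨hp, hP⟩ := hP x ρ B hx hρ
  obtain ⟨hq, hQ⟩ := hQ x ρ B hx hρ
  simp only [Polynomial.eval_add, Polynomial.eval_one, Polynomial.eval_mul, Polynomial.eval_ofNat]
  refine ⟨by omega, fun r d s hs => ?_⟩
  have h₁ := hs.free (d + 1) (by omega)
  refine ((hP r d s hs).seq ((hQ r (d + 1) _ (hs.update _)).seq (exec_sub _ _))).congr
    (by omega) ?_
  funext j
  simp only [Function.update_apply]
  split_ifs <;> simp_all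

/-- The value of `F` stays on stack `d` as a new variable while `G` is computed one level higher,
and is then replaced by the result. The arguments of `G` are at most `B + p(B)`, whence the
composition with `X + p` in the budget. -/
theorem letIn {G : List Bool → (Fin (n + 1) → ℕ) → ℕ} (hF : PolyFn F) (hG : PolyFn G) :
    PolyFn fun x ρ => G x (Fin.cons (F x ρ) ρ) := by
  obtain ⟨P, p, hP⟩ := hF
  obtain ⟨Q, q, hQ⟩ := hG
  refine ⟨fun r d => seq (P r d) (seq (Q (Fin.cons d r) (d + 1))
    (seq (clear d) (move (d + 1) d))),
    p + (q.comp (Polynomial.X + p) + (2 * p + 1 + (2 * q.comp (Polynomial.X + p) + 1))),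
    fun x ρ B hx hρ => ?_⟩
  obtain ⟨hp, hP⟩ := hP x ρ B hx hρ
  obtain ⟨hq, hQ⟩ := hQ x (Fin.cons (F x ρ) ρ) (B + p.eval B) (by omega) (fun i => by
    induction i using Fin.cases with
    | zero => rw [Fin.cons_zero]; omega
    | succ i => rw [Fin.cons_succ]; have := hρ i; omega)
  simp only [Polynomial.eval_add, Polynomial.eval_one, Polynomial.eval_mul, Polynomial.eval_ofNat,
    Polynomial.eval_comp, Polynomial.eval_X]
  refine ⟨by omega, fun r d s hs => ?_⟩
  have h₁ := hs.free (d + 1) (by omega)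
  refine ((hP r d s hs).seq ((hQ _ (d + 1) _ ((hs.update _).bind hs.two_le (by simp))).seq
    ((exec_clear (num (F x ρ)) _ (by simp)).seq
      (exec_move (by omega) (num (G x (Fin.cons (F x ρ) ρ))) _ (by simp))))).congr ?_ ?_
  · simp only [List.length_replicate]; omega
  · funext j
    simp only [Function.update_apply]
    split_ifs <;> simp_all

/-- Primitive recursion with polynomially bounded values. -/
theorem natRec {base cnt : List Bool → (Fin n → ℕ) → ℕ}
    {body : List Bool → (Fin (n + 2) → ℕ) → ℕ} (hbase : PolyFn base) (hcnt : PolyFn cnt)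
    (hbody : PolyFn body) (val : List Bool → (Fin n → ℕ) → ℕ → ℕ)
    (hval₀ : ∀ x ρ, val x ρ 0 = base x ρ)
    (hval : ∀ x ρ i, val x ρ (i + 1) =
      body x (Fin.cons (val x ρ i) (Fin.cons i ρ : Fin (n + 1) → ℕ)))
    (w : Polynomial ℕ) (hw : ∀ x ρ B, x.length ≤ B → (∀ i, ρ i ≤ B) → ∀ i ≤ cnt x ρ,
      val x ρ i ≤ w.eval B) :
    PolyFn fun x ρ => val x ρ (cnt x ρ) := by
  obtain ⟨P₀, p₀, hP₀⟩ := hbase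
  obtain ⟨P, p, hP⟩ := hcnt
  obtain ⟨Q, q, hQ⟩ := hbody
  -- Stack `d` counts down, `d + 1` holds the index, `d + 2` the current value and `d + 3` the next
  -- value.
  refine ⟨fun r d => seq (P r d) (seq (P₀ r (d + 2)) (seq
    (loop d skip (seq (Q (Fin.cons (d + 2) (Fin.cons (d + 1) r : Fin (n + 1) → ℕ)) (d + 3))
      (seq (clear (d + 2)) (seq (move (d + 3) (d + 2)) (push (d + 1) true)))))
    (seq (clear (d + 1)) (move (d + 2) d)))),
    p + (p₀ + (p * (q.comp (Polynomial.X + p + w) + (2 * w + 1 + (2 * w + 1 + 1)) + 1) + 1 +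
      (2 * p + 1 + (2 * w + 1)))), fun x ρ B hx hρ => ?_⟩
  obtain ⟨hp₀, hP₀⟩ := hP₀ x ρ B hx hρ
  obtain ⟨hp, hP⟩ := hP x ρ B hx hρ
  have hw := hw x ρ B hx hρ
  simp only [Polynomial.eval_add, Polynomial.eval_one, Polynomial.eval_mul, Polynomial.eval_ofNat,
    Polynomial.eval_comp, Polynomial.eval_X]
  -- The cost of one pass. It is uniform because `w` bounds all intermediate values; without such a
  -- bound, iterating a polynomial-time body could produce exponentially large values.
  set c := q.eval (B + p.eval B + w.eval B) + (2 * w.eval B + 1 + (2 * w.eval B + 1 + 1)) with hc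
  have hwn := hw _ le_rfl
  refine ⟨by omega, fun r d s hs => ?_⟩
  have h₁ := hs.free (d + 1) (by omega)
  have h₂ := hs.free (d + 2) (by omega)
  have h₃ := hs.free (d + 3) (by omega)
  set N := cnt x ρ with hN
  have hloop := exec_loop_num (k := d) (F := skip) (T := (seq
      (Q (Fin.cons (d + 2) (Fin.cons (d + 1) r : Fin (n + 1) → ℕ)) (d + 3))
      (seq (clear (d + 2)) (seq (move (d + 3) (d + 2)) (push (d + 1) true))))) (c := c) N
      (fun i => update (update (update s d (num (N - i))) (d + 1) (num i)) (d + 2)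
        (num (val x ρ i))) (fun i _ => by simp) (by
    intro i hi
    have hvi := hw i hi.le
    have hvi' := hw (i + 1) hi
    obtain ⟨-, hQ⟩ := hQ x (Fin.cons (val x ρ i) (Fin.cons i ρ : Fin (n + 1) → ℕ))
      (B + p.eval B + w.eval B) (by omega) (fun j => by
        induction j using Fin.cases with
        | zero => rw [Fin.cons_zero]; omega
        | succ j =>
          rw [Fin.cons_succ]
          induction j using Fin.cases with
          | zero => rw [Fin.cons_zero]; omega
          | succ j => rw [Fin.cons_succ]; have := hρ j; omega)
    have e : update (update (update (update s d (num (N - i))) (d + 1) (num i)) (d + 2)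
        (num (val x ρ i))) d (num (N - i - 1)) =
        update (update (update s d (num (N - i - 1))) (d + 1) (num i)) (d + 2)
        (num (val x ρ i)) := by
      funext j
      simp only [Function.update_apply]
      split_ifs <;> first | rfl | omega
    rw [e]
    have hr := (((hs.update (num (N - i - 1))).update (num i)).bind (a := i) (by have := hs.two_le; omega)
      (by simp)).update (num (val x ρ i))
    have hr := hr.bind (a := val x ρ i) (by have := hs.two_le; omega) (by simp)
    refine ((hQ _ (d + 3) _ hr).seq ((exec_clear (num (val x ρ i)) _ (by simp)).seq
      ((exec_move (by omega) (num (val x ρ (i + 1))) _ (by simp [hval])).seq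
        (Exec.push _ _ _)))).congr ?_ ?_
    · simp only [List.length_replicate]; omega
    · funext j
      simp only [Function.update_apply]
      split_ifs <;> first | omega | simp_all [List.replicate_succ, Nat.sub_sub])
  have e₀ : update (update s d (num N)) (d + 2) (num (base x ρ)) =
      update (update (update s d (num (N - 0))) (d + 1) (num 0)) (d + 2) (num (val x ρ 0)) := by
    rw [hval₀]
    funext j
    simp only [Function.update_apply]
    split_ifs <;> simp_all
  have hle : N * (c + 1) + 1 ≤ p.eval B * (c + 1) + 1 := by gcongr
  refine ((hP r d s hs).seq (((hP₀ r (d + 2) _ ((hs.update _).mono (by omega))).congr le_rfl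
    e₀).seq (hloop.seq ((exec_clear (num N) _ (by simp)).seq
      (exec_move (by omega) (num (val x ρ N)) _ (by simp)))))).congr ?_ ?_
  · simp only [List.length_replicate]; omega
  · funext j
    by_cases h₄ : j = d
    · subst h₄
      simp
    · by_cases h₅ : j = d + 1
      · subst h₅
        simp [h₁]
      · by_cases h₆ : j = d + 2
        · subst h₆
          simp [h₂]
        · simp [h₄, h₅, h₆]

theorem weaken (hF : PolyFn F) : PolyFn fun x (ρ : Fin (n + 1) → ℕ) => F x (Fin.tail ρ) :=
  hF.reindex Fin.succ

theorem exists_bound (hF : PolyFn F) : ∃ p : Polynomial ℕ, ∀ x ρ B, x.length ≤ B →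
    (∀ i, ρ i ≤ B) → F x ρ ≤ p.eval B := by
  obtain ⟨P, p, h⟩ := hF
  exact ⟨p, fun x ρ B hx hρ => (h x ρ B hx hρ).1⟩

theorem mul (hF : PolyFn F) (hG : PolyFn G) : PolyFn fun x ρ => F x ρ * G x ρ := by
  obtain ⟨p, hp⟩ := hF.exists_bound
  obtain ⟨q, hq⟩ := hG.exists_bound
  refine natRec (const 0) hF ((proj 0).add hG.weaken.weaken) (fun x ρ i => i * G x ρ)
    (fun x ρ => by simp) (fun x ρ i => ?_) (p * q) (fun x ρ B hx hρ i hi => ?_)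
  · simp [Nat.succ_mul]
  · rw [Polynomial.eval_mul]
    exact Nat.mul_le_mul (hi.trans (hp x ρ B hx hρ)) (hq x ρ B hx hρ)

/-- The `i`-th bit of `x` as a number; `0` beyond the end of `x`. -/
def _root_.bitAt (x : List Bool) (i : ℕ) : ℕ := (x.getD i false).toNat

/-- The input is a stack, so position `n` is reached by parking the first `n` bits on stack `d + 1`.
Past the end of the input the pops do nothing, in agreement with `take` and `drop`. -/
theorem exec_skipBits {d : ℕ} (hd : 2 ≤ d) {s : ℕ → List Bool} (x : List Bool) (n : ℕ) :
    Exec (loop d skip (ifPop 0 skip (push (d + 1) false) (push (d + 1) true)))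
      (update (update (update s 0 x) d (num n)) (d + 1) []) (n * 3 + 1)
      (update (update (update s 0 (x.drop n)) d []) (d + 1) (x.take n).reverse) := by
  have h := exec_loop_num (k := d) (F := skip)
    (T := ifPop 0 skip (push (d + 1) false) (push (d + 1) true)) (c := 2) n
    (fun i => update (update (update s 0 (x.drop i)) d (num (n - i))) (d + 1) (x.take i).reverse)
    (fun i _ => by simp) ?_
  · simpa using h
  · intro i hi
    have e : update (update (update (update s 0 (x.drop i)) d (num (n - i))) (d + 1)
        (x.take i).reverse) d (num (n - i - 1)) =
        update (update (update s 0 (x.drop i)) d (num (n - (i + 1)))) (d + 1)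
          (x.take i).reverse := by
      funext j
      simp only [Function.update_apply]
      split_ifs <;> first | rfl | omega
    rw [e]
    have h0 : update (update (update s 0 (x.drop i)) d (num (n - (i + 1)))) (d + 1)
          (x.take i).reverse 0 = x.drop i := by
      rw [Function.update_of_ne (by omega), Function.update_of_ne (by omega),
        Function.update_self]
    rcases Nat.lt_or_ge i x.length with hx | hx
    · refine (Exec.ifPop_cons (t := 1) (a := x[i]) (l := x.drop (i + 1))
        (by rw [h0, List.drop_eq_getElem_cons hx]) (s' := update (update (update s 0
          (x.drop (i + 1))) d (num (n - (i + 1)))) (d + 1) (x.take (i + 1)).reverse) ?_).congr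
        le_rfl rfl
      rw [List.take_add_one, List.getElem?_eq_getElem hx]
      cases x[i] <;> refine (Exec.push _ _ _).congr le_rfl ?_ <;>
      · funext j
        simp only [Function.update_apply]
        split_ifs <;> first | omega | contradiction | simp
    · refine (Exec.ifPop_nil (by rw [h0, List.drop_eq_nil_of_le hx]) (Exec.skip _)).congr le_rfl ?_
      rw [List.drop_eq_nil_of_le hx, List.drop_eq_nil_of_le (by omega), List.take_of_length_le hx,
        List.take_of_length_le (by omega)]

/-- After the skip, the top bit is read and pushed back, and the parked prefix is returned, so that
the input is intact afterwards. -/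
theorem bit (hF : PolyFn F) : PolyFn fun x ρ => bitAt x (F x ρ) := by
  obtain ⟨P, p, hP⟩ := hF
  refine ⟨fun r d => seq (P r d)
    (seq (loop d skip (ifPop 0 skip (push (d + 1) false) (push (d + 1) true)))
    (seq (ifPop 0 skip (push 0 false) (seq (push 0 true) (push d true))) (move (d + 1) 0))),
    p + (p * 3 + 1 + (3 + (2 * Polynomial.X + 1))), fun x ρ B hx hρ => ?_⟩
  obtain ⟨hp, hP⟩ := hP x ρ B hx hρ
  simp only [Polynomial.eval_add, Polynomial.eval_one, Polynomial.eval_mul, Polynomial.eval_ofNat,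
    Polynomial.eval_X]
  refine ⟨?_, fun r d s hs => ?_⟩
  · have : bitAt x (F x ρ) ≤ 1 := Bool.toNat_le _
    omega
  have hd := hs.two_le
  have h₁ := hs.free (d + 1) (by omega)
  have h₂ := hs.free d le_rfl
  have h₀ := hs.input
  set N := F x ρ with hN
  have hskip := exec_skipBits hd (s := s) x N
  have e : update (update (update s 0 x) d (num N)) (d + 1) [] = update s d (num N) := by
    rw [← h₀, Function.update_eq_self]
    funext j
    simp only [Function.update_apply]
    split_ifs <;> simp_all
  rw [e] at hskip
  have hbit : Exec (ifPop 0 skip (push 0 false) (seq (push 0 true) (push d true)))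
      (update (update (update s 0 (x.drop N)) d []) (d + 1) (x.take N).reverse) 3
      (update (update (update s 0 (x.drop N)) d (num (bitAt x N))) (d + 1)
        (x.take N).reverse) := by
    have h0 : update (update (update s 0 (x.drop N)) d []) (d + 1) (x.take N).reverse 0 =
        x.drop N := by
      rw [Function.update_of_ne (by omega), Function.update_of_ne (by omega),
        Function.update_self]
    rcases Nat.lt_or_ge N x.length with hx | hx
    · have hb : bitAt x N = x[N].toNat := by simp [bitAt, hx]
      have hdrop := List.drop_eq_getElem_cons hx
      rw [hb]
      rw [hdrop] at h0 ⊢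
      refine Exec.ifPop_cons (t := 2) h0 ?_
      cases x[N]
      · refine (Exec.push _ _ _).congr (by omega) ?_
        funext j
        simp only [Function.update_apply]
        split_ifs <;> first | omega | simp_all
      · refine ((Exec.push _ _ _).seq (Exec.push _ _ _)).congr (by omega) ?_
        funext j
        simp only [Function.update_apply]
        split_ifs <;> first | omega | simp_all
    · refine (Exec.ifPop_nil (by rw [h0, List.drop_eq_nil_of_le hx]) (Exec.skip _)).congr
        (by omega) ?_
      have hb : bitAt x N = 0 := by simp [bitAt, hx]
      rw [hb]
      rfl
  refine ((hP r d s hs).seq (hskip.seq (hbit.seq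
    (exec_move (by omega) (x.take N).reverse _ (by simp))))).congr ?_ ?_
  · simp only [List.length_reverse, List.length_take]; omega
  · funext j
    simp only [Function.update_apply]
    split_ifs <;> first | omega | simp_all

end PolyFn

/-- `F x ρ` is a word computed in time polynomial in the length of `x` and in the numbers `ρ i`. -/
def PolyWord {n : ℕ} (F : List Bool → (Fin n → ℕ) → List Bool) : Prop :=
  ∃ (P : (Fin n → ℕ) → ℕ → StackProg) (q : Polynomial ℕ), ∀ x ρ B, x.length ≤ B → (∀ i, ρ i ≤ B) →
    (F x ρ).length ≤ q.eval B ∧ ∀ r d s, Ready x ρ r d s →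
      Exec (P r d) s (q.eval B) (update s 1 ((F x ρ).reverse ++ s 1))

/-! ### Closure properties of words computed in polynomial time -/

namespace PolyWord

variable {n : ℕ} {F G : List Bool → (Fin n → ℕ) → List Bool}

theorem of_eq (hF : PolyWord F) (h : ∀ x ρ, F x ρ = G x ρ) : PolyWord G := by
  have : F = G := funext fun x => funext (h x)
  exact this ▸ hF

/-- The output is accumulated in reverse on stack `1`, so concatenation is execution in sequence. -/
theorem append (hF : PolyWord F) (hG : PolyWord G) : PolyWord fun x ρ => F x ρ ++ G x ρ := by
  obtain ⟨P, p, hP⟩ := hF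
  obtain ⟨Q, q, hQ⟩ := hG
  refine ⟨fun r d => seq (P r d) (Q r d), p + q, fun x ρ B hx hρ => ?_⟩
  obtain ⟨hp, hP⟩ := hP x ρ B hx hρ
  obtain ⟨hq, hQ⟩ := hQ x ρ B hx hρ
  rw [Polynomial.eval_add, List.length_append]
  refine ⟨by omega, fun r d s hs => ?_⟩
  refine ((hP r d s hs).seq (hQ r d _ (hs.output _))).congr le_rfl ?_
  simp

theorem singleton {f : List Bool → (Fin n → ℕ) → ℕ} (hf : PolyFn f) :
    PolyWord fun x ρ => [decide (f x ρ ≠ 0)] := by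
  obtain ⟨P, p, hP⟩ := hf
  refine ⟨fun r d => seq (P r d) (seq (ifPop d (push 1 false) skip (push 1 true)) (clear d)),
    p + (2 + (2 * p + 1)), fun x ρ B hx hρ => ?_⟩
  obtain ⟨hp, hP⟩ := hP x ρ B hx hρ
  simp only [Polynomial.eval_add, Polynomial.eval_one, Polynomial.eval_mul, Polynomial.eval_ofNat,
    List.length_singleton]
  refine ⟨by omega, fun r d s hs => ?_⟩
  have hd := hs.two_le
  have hfree := hs.free d le_rfl
  cases hc : f x ρ with
  | zero =>
    refine ((hP r d s hs).seq ((Exec.ifPop_nil (by simp [hc]) (Exec.push _ _ _)).seq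
      (exec_clear [] _ ?_))).congr ?_ ?_
    · rw [hc, Function.update_of_ne (by omega), Function.update_self]; rfl
    · rw [List.length_nil]; omega
    · funext j
      simp only [Function.update_apply]
      split_ifs <;> first | omega | simp_all
  | succ c =>
    refine ((hP r d s hs).seq ((Exec.ifPop_cons (a := true) (l := num c)
      (by simp [hc, List.replicate_succ]) (Exec.push _ _ _)).seq
      (exec_clear (num c) _ ?_))).congr ?_ ?_
    · rw [Function.update_of_ne (by omega), Function.update_self]
    · rw [List.length_replicate]; omega
    · funext j
      simp only [Function.update_apply]
      split_ifs <;> first | omega | simp_all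

/-- Unlike in `natRec`, no bound on intermediate results is needed: the output is never read back,
so each pass has the same cost bound and adds a polynomially bounded piece. -/
theorem flatMap_range {f : List Bool → (Fin n → ℕ) → ℕ}
    {G : List Bool → (Fin (n + 1) → ℕ) → List Bool} (hf : PolyFn f) (hG : PolyWord G) :
    PolyWord fun x ρ => (List.range (f x ρ)).flatMap fun i => G x (Fin.cons i ρ) := by
  obtain ⟨P, p, hP⟩ := hf
  obtain ⟨Q, q, hQ⟩ := hG
  refine ⟨fun r d => seq (P r d) (seq
    (loop d skip (seq (Q (Fin.cons (d + 1) r) (d + 2)) (push (d + 1) true))) (clear (d + 1))),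
    p + (p * (q.comp (Polynomial.X + p) + 1 + 1) + 1 + (2 * p + 1)), fun x ρ B hx hρ => ?_⟩
  obtain ⟨hp, hP⟩ := hP x ρ B hx hρ
  simp only [Polynomial.eval_add, Polynomial.eval_one, Polynomial.eval_mul, Polynomial.eval_ofNat,
    Polynomial.eval_comp, Polynomial.eval_X]
  set c := q.eval (B + p.eval B) with hc
  have hQ : ∀ i < f x ρ, _ := fun i hi => hQ x (Fin.cons i ρ) (B + p.eval B) (by omega) (fun j => by
    induction j using Fin.cases with
    | zero => rw [Fin.cons_zero]; omega
    | succ j => rw [Fin.cons_succ]; have := hρ j; omega)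
  rw [← hc] at hQ
  refine ⟨?_, fun r d s hs => ?_⟩
  · have h : ((List.range (f x ρ)).flatMap fun i => G x (Fin.cons i ρ)).length ≤ f x ρ * c := by
      rw [List.length_flatMap]
      refine (List.sum_le_card_nsmul _ c ?_).trans (by simp)
      intro y hy
      obtain ⟨i, hi, rfl⟩ := List.mem_map.1 hy
      exact (hQ i (List.mem_range.1 hi)).1
    have : f x ρ * c ≤ p.eval B * (c + 1 + 1) := Nat.mul_le_mul hp (by omega)
    omega
  · have hd := hs.two_le
    have h₁ := hs.free (d + 1) (by omega)
    have h₂ := hs.free d le_rfl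
    have n₁ : 1 ≠ d := by omega
    have n₃ : d ≠ 0 := by omega
    have hloop := exec_loop_num (k := d) (F := skip)
      (T := seq (Q (Fin.cons (d + 1) r) (d + 2)) (push (d + 1) true)) (c := c + 1) (f x ρ)
      (fun i => update (update (update s 1
        (((List.range i).flatMap fun i => G x (Fin.cons i ρ)).reverse ++ s 1)) d
          (num (f x ρ - i))) (d + 1) (num i)) (fun i _ => by simp) (by
      intro i hi
      have e : update (update (update (update s 1
          (((List.range i).flatMap fun i => G x (Fin.cons i ρ)).reverse ++ s 1)) d
          (num (f x ρ - i))) (d + 1) (num i)) d (num (f x ρ - i - 1)) =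
          update (update (update s 1
          (((List.range i).flatMap fun i => G x (Fin.cons i ρ)).reverse ++ s 1)) d
          (num (f x ρ - i - 1))) (d + 1) (num i) := by
        funext j
        simp only [Function.update_apply]
        split_ifs <;> first | rfl | omega
      rw [e]
      have hr := ((((hs.output (((List.range i).flatMap fun i =>
        G x (Fin.cons i ρ)).reverse ++ s 1)).update (num (f x ρ - i - 1))).update (num i)).bind
          (a := i) (by omega) (by simp))
      refine (((hQ i hi).2 _ _ _ hr).seq (Exec.push _ _ _)).congr le_rfl ?_
      rw [List.range_succ, List.flatMap_append, Nat.sub_sub]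
      funext j
      by_cases h₃ : j = 1
      · subst h₃
        simp [n₁, n₃]
      · by_cases h₄ : j = d + 1
        · subst h₄
          simp [List.replicate_succ, n₃, Function.update_apply]
        · simp [h₃, h₄, Function.update_apply])
    have e₀ : update s d (num (f x ρ)) = update (update (update s 1
        (((List.range 0).flatMap fun i => G x (Fin.cons i ρ)).reverse ++ s 1)) d
          (num (f x ρ - 0))) (d + 1) (num 0) := by
      funext j
      simp only [Function.update_apply]
      split_ifs <;> simp_all
    have hle : f x ρ * (c + 1 + 1) + 1 ≤ p.eval B * (c + 1 + 1) + 1 := by gcongr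
    refine (((hP r d s hs).congr le_rfl e₀).seq (hloop.seq
      (exec_clear (num (f x ρ)) _ (by simp)))).congr ?_ ?_
    · simp only [List.length_replicate]; omega
    · funext j
      by_cases h₃ : j = d
      · subst h₃
        rw [Function.update_of_ne (by omega), Function.update_of_ne (by omega),
          Function.update_self, Function.update_of_ne (by omega), h₂]
        simp
      · by_cases h₄ : j = d + 1
        · subst h₄
          rw [Function.update_self, Function.update_of_ne (by omega), h₁]
        · simp [h₃, h₄, Function.update_apply]

end PolyWord

end StackProg

/-! ### Transfer of running times along reductions -/

open StackProg in
/-- Solvability carries over along polynomial-time reductions that do not increase the time bound by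
more than a constant factor. -/
theorem SolvableInOStar.of_reduction {α β : Type} {enc : α → List Bool} {enc' : β → List Bool}
    {P : α → Prop} {P' : β → Prop} {T : α → ℝ} {T' : β → ℝ} {F : List Bool → (Fin 0 → ℕ) → List Bool}
    (hF : PolyWord F) (g : α → β) (hg : ∀ a ρ, F (enc a) ρ = enc' (g a))
    (hP : ∀ a, P' (g a) ↔ P a) (hT : ∀ a, 1 ≤ T a) (C : ℕ) (hT' : ∀ a, T' (g a) ≤ C * T a)
    (h : SolvableInOStar enc' P' T') : SolvableInOStar enc P T := by
  obtain ⟨M, p, hM⟩ := h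
  obtain ⟨R, q, hR⟩ := hF
  -- `host_outputs` expects every stack but the output stack to be empty at the end, so the input is
  -- erased.
  set R' : StackProg := seq (R Fin.elim0 2) (clear 0) with hR'
  refine ⟨host R'.maxStack M R', q + (2 * Polynomial.X + 1) + (q + 1) +
    (C : Polynomial ℕ) * p.comp q, fun a => ?_⟩
  obtain ⟨hq, hR⟩ := hR (enc a) Fin.elim0 (enc a).length le_rfl (fun i => i.elim0)
  rw [hg] at hq hR
  obtain ⟨b, t, hb, ht, hout⟩ := hM (g a)
  have hmap : (enc a).map (host R'.maxStack M R').inputAlphabet.symm = enc a := List.map_id _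
  suffices hexec : Exec R' (update (fun _ => []) 0 (enc a))
      (q.eval (enc a).length + (2 * (enc a).length + 1))
      (update (fun _ => []) 1 (enc' (g a)).reverse) by
    refine ⟨b, q.eval (enc a).length + (2 * (enc a).length + 1) + ((enc' (g a)).length + 1) + t,
      hb.trans (hP a), ?_,
      hmap.symm ▸ host_outputs (m := R'.maxStack) (by omega) hexec hout⟩
    have hp : p.eval (enc' (g a)).length ≤ p.eval (q.eval (enc a).length) :=
      p.eval_mono_nat hq
    have h₁ : (t : ℝ) ≤ T a * (C * p.eval (q.eval (enc a).length) : ℕ) := by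
      refine ht.trans ?_
      calc T' (g a) * (p.eval (enc' (g a)).length : ℕ)
          ≤ (C * T a) * (p.eval (q.eval (enc a).length) : ℕ) := by
            gcongr
            · have := hT a; positivity
            · exact hT' a
        _ = _ := by push_cast; ring
    simp only [Polynomial.eval_add, Polynomial.eval_one, Polynomial.eval_mul,
      Polynomial.eval_ofNat, Polynomial.eval_comp, Polynomial.eval_X, Polynomial.eval_natCast, Nat.cast_id]
    -- Since `T a ≥ 1`, the time for the reduction itself is absorbed into the polynomial factor.
    have h₂ : ((q.eval (enc a).length + (2 * (enc a).length + 1) + ((enc' (g a)).length + 1) : ℕ) : ℝ)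
        ≤ T a * (q.eval (enc a).length + (2 * (enc a).length + 1) + (q.eval (enc a).length + 1) : ℕ) := by
      refine le_trans ?_ (le_mul_of_one_le_left (Nat.cast_nonneg _) (hT a))
      exact_mod_cast Nat.add_le_add_left (Nat.add_le_add_right hq 1) _
    rw [Nat.cast_add, Nat.cast_add _ (C * _), mul_add]
    exact add_le_add h₂ h₁
  have hready : Ready (enc a) (Fin.elim0 : Fin 0 → ℕ) Fin.elim0 2
      (update (fun _ => []) 0 (enc a)) :=
    ⟨le_rfl, fun i => i.elim0, fun i => i.elim0, by simp, fun i => i.elim0,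
      fun j hj => by rw [Function.update_of_ne (by omega)]⟩
  refine ((hR Fin.elim0 2 _ hready).seq (exec_clear (enc a) _ (by simp))).congr le_rfl ?_
  funext j
  simp only [Function.update_apply]
  split_ifs <;> simp_all

/-! ### Incidence graphs -/

/-- The bipartite graph between the elements `0, …, E - 1` and `t` copies of each of the sets
`W 0, …, W (C - 1)`, in which an element is adjacent to the sets it belongs to. -/
def incidenceGraph (E C t : ℕ) (W : ℕ → Finset ℕ) : SimpleGraph (Fin (E + C * t)) where
  Adj u v := ((u : ℕ) < E ∧ E ≤ v ∧ (u : ℕ) ∈ W ((v - E) / t)) ∨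
    ((v : ℕ) < E ∧ E ≤ u ∧ (v : ℕ) ∈ W ((u - E) / t))
  symm := ⟨fun _ _ h => h.symm⟩
  loopless := ⟨fun u h => by omega⟩

namespace incidenceGraph

variable {E C t : ℕ} {W : ℕ → Finset ℕ}

/-- The vertex of an element. -/
def elem (C t : ℕ) {E : ℕ} (e : ℕ) (he : e < E) : Fin (E + C * t) :=
  ⟨e, he.trans_le (Nat.le_add_right _ _)⟩

/-- The vertex of the `i`-th copy of a set. -/
def copy (E : ℕ) {C t : ℕ} (c i : ℕ) (hc : c < C) (hi : i < t) : Fin (E + C * t) :=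
  ⟨E + (c * t + i), by
    have : (c + 1) * t ≤ C * t := Nat.mul_le_mul_right t hc
    rw [Nat.succ_mul] at this
    omega⟩

theorem adj_elem_copy {e c i : ℕ} (he : e < E) (hc : c < C) (hi : i < t) :
    (incidenceGraph E C t W).Adj (elem C t e he) (copy E c i hc hi) ↔ e ∈ W c := by
  have h : (E + (c * t + i) - E) / t = c := by
    rw [Nat.add_sub_cancel_left, Nat.add_comm, Nat.add_mul_div_right _ _ (by omega),
      Nat.div_eq_of_lt hi, Nat.zero_add]
  constructor
  · rintro (⟨-, -, h'⟩ | ⟨h', -⟩)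
    · change e ∈ W ((E + (c * t + i) - E) / t) at h'
      rwa [h] at h'
    · change E + _ < E at h'
      omega
  · intro h'
    refine Or.inl ⟨he, Nat.le_add_right _ _, ?_⟩
    change e ∈ W ((E + (c * t + i) - E) / t)
    rwa [h]

theorem exists_elem_or_copy (v : Fin (E + C * t)) :
    (∃ e, ∃ he : e < E, v = elem C t e he) ∨
      ∃ c i, ∃ (hc : c < C) (hi : i < t), v = copy E c i hc hi := by
  rcases Nat.lt_or_ge v E with h | h
  · exact Or.inl ⟨v, h, rfl⟩
  · have hlt : (v : ℕ) - E < C * t := by omega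
    have ht : 0 < t := Nat.pos_of_ne_zero fun h0 => by simp [h0] at hlt
    refine Or.inr ⟨(v - E) / t, (v - E) % t, Nat.div_lt_of_lt_mul (hlt.trans_eq (Nat.mul_comm _ _)),
      Nat.mod_lt _ ht, ?_⟩
    ext
    change (v : ℕ) = E + _
    rw [Nat.div_add_mod']
    omega

theorem not_adj_elem_elem {e e' : ℕ} (he : e < E) (he' : e' < E) :
    ¬ (incidenceGraph E C t W).Adj (elem C t e he) (elem C t e' he') := by
  rintro (⟨-, h, -⟩ | ⟨-, h, -⟩)
  · exact absurd he' (not_lt.2 h)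
  · exact absurd he (not_lt.2 h)

theorem not_adj_copy_copy {c i c' i' : ℕ} (hc : c < C) (hi : i < t) (hc' : c' < C) (hi' : i' < t) :
    ¬ (incidenceGraph E C t W).Adj (copy E c i hc hi) (copy E c' i' hc' hi') := by
  rintro (⟨h, -⟩ | ⟨h, -⟩) <;> exact absurd h (not_lt.2 (Nat.le_add_right _ _))

/-- The number of neighbours of a set in a vertex set without copies of sets. -/
theorem degreeIn_copy (hW : ∀ c, W c ⊆ Finset.range E) {c i : ℕ} (hc : c < C) (hi : i < t)
    (S : Finset (Fin (E + C * t))) (S' : Finset ℕ)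
    (hS : ∀ e (he : e < E), elem C t e he ∈ S ↔ e ∈ S') :
    (incidenceGraph E C t W).degreeIn S (copy E c i hc hi) = (W c ∩ S').card := by
  classical
  symm
  refine Finset.card_bij' (fun e he => elem C t e
    (Finset.mem_range.1 (hW c (Finset.mem_inter.1 he).1))) (fun v _ => (v : ℕ)) ?_ ?_ ?_ ?_
  · intro e he
    rw [Finset.mem_inter] at he
    have he' := Finset.mem_range.1 (hW c he.1)
    exact Finset.mem_filter.2 ⟨(hS e he').2 he.2, ((adj_elem_copy he' hc hi).2 he.1).symm⟩
  · intro v hv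
    rw [Finset.mem_filter] at hv
    rcases exists_elem_or_copy v with ⟨e, he, rfl⟩ | ⟨c', i', hc', hi', rfl⟩
    · exact Finset.mem_inter.2 ⟨(adj_elem_copy he hc hi).1 hv.2.symm, (hS e he).1 hv.1⟩
    · exact absurd hv.2 (not_adj_copy_copy hc hi hc' hi')
  · intro e he; rfl
  · intro v hv; rfl

/-- All `t` copies of a set containing the element are neighbours. With `t ≥ 2k` this keeps the
element out of `N(S)` for every alliance with `|S| ≤ k`. -/
theorem le_degreeIn_univ_elem {e c : ℕ} (he : e < E) (hc : c < C) (hec : e ∈ W c) :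
    t ≤ (incidenceGraph E C t W).degreeIn Finset.univ (elem C t e he) := by
  classical
  have : (Finset.univ : Finset (Fin t)).card ≤
      (incidenceGraph E C t W).degreeIn Finset.univ (elem C t e he) := by
    refine Finset.card_le_card_of_injOn (fun i => copy E c i hc i.2) ?_ ?_
    · intro i _
      exact Finset.mem_coe.2 (Finset.mem_filter.2
        ⟨Finset.mem_univ _, (adj_elem_copy he hc i.2).2 hec⟩)
    · intro i _ j _ hij
      have : E + (c * t + i) = E + (c * t + j) := congrArg Fin.val hij
      ext
      omega
  simpa using this

theorem _root_.SimpleGraph.degreeIn_add_compl {V : Type*} [Fintype V] [DecidableEq V]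
    (G : SimpleGraph V) (S : Finset V) (v : V) :
    G.degreeIn S v + G.degreeIn Sᶜ v = G.degreeIn Finset.univ v := by
  classical
  unfold SimpleGraph.degreeIn
  rw [← Finset.card_union_of_disjoint
    (Finset.disjoint_filter_filter disjoint_compl_right), ← Finset.filter_union,
    Finset.union_compl]

theorem _root_.SimpleGraph.degreeIn_le_card {V : Type*} [Fintype V] [DecidableEq V]
    (G : SimpleGraph V) (S : Finset V) (v : V) : G.degreeIn S v ≤ S.card := by
  classical
  exact Finset.card_filter_le _ _

/-- Small offensive alliances of an incidence graph are the sets of elements that contain more than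
half of each set they meet, provided there are many copies and all sets are large. -/
theorem exists_isOffensiveAlliance_iff {k : ℕ} (hW : ∀ c, W c ⊆ Finset.range E)
    (hk : 0 < k) (ht : 2 * k ≤ t) (hcard : ∀ c < C, k < (W c).card) :
    (∃ S, (incidenceGraph E C t W).IsOffensiveAlliance S ∧ S.card ≤ k) ↔
      ∃ S ⊆ Finset.range E, S.Nonempty ∧ S.card ≤ k ∧
        ∀ c < C, (W c ∩ S).Nonempty → (W c \ S).card < (W c ∩ S).card := by
  classical
  have hcompl : ∀ (S : Finset (Fin (E + C * t))) (S' : Finset ℕ),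
      (∀ e (he : e < E), elem C t e he ∈ S ↔ e ∈ S') → ∀ c i (hc : c < C) (hi : i < t),
      (incidenceGraph E C t W).degreeIn Sᶜ (copy E c i hc hi) = (W c \ S').card := by
    intro S S' hS c i hc hi
    have h₁ := (incidenceGraph E C t W).degreeIn_add_compl S (copy E c i hc hi)
    rw [degreeIn_copy hW hc hi S S' hS, degreeIn_copy hW hc hi Finset.univ (Finset.range E)
      (fun e he => by simp [he]), Finset.inter_eq_left.2 (hW c)] at h₁
    have h₂ := Finset.card_inter_add_card_sdiff (W c) S'
    omega
  constructor
  · rintro ⟨S, ⟨hne, hS⟩, hSk⟩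
    -- A copy in `S` would put all elements of its set into `S`: an element left out would lie in
    -- `N(S)` with at most `k` neighbours in `S` and at least `k` outside. But the set has more than
    -- `k` elements.
    have hcopy : ∀ c i (hc : c < C) (hi : i < t), copy E c i hc hi ∉ S := by
      intro c i hc hi hmem
      have hsub : ∀ e ∈ W c, ∃ he : e < E, elem C t e he ∈ S := by
        intro e hec
        have he := Finset.mem_range.1 (hW c hec)
        refine ⟨he, ?_⟩
        by_contra hne
        have h₁ := hS (elem C t e he) ⟨hne, _, hmem, ((adj_elem_copy he hc hi).2 hec).symm⟩
        have h₂ := (incidenceGraph E C t W).degreeIn_add_compl S (elem C t e he)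
        have h₃ := (incidenceGraph E C t W).degreeIn_le_card S (elem C t e he)
        have h₄ := le_degreeIn_univ_elem (t := t) (W := W) he hc hec
        omega
      have : (W c).card ≤ S.card := by
        refine Finset.card_le_card_of_injOn
          (fun e => if he : e < E then elem C t e he else copy E c i hc hi) ?_ ?_
        · intro e he
          obtain ⟨h, h'⟩ := hsub e he
          simpa [h] using h'
        · intro e he e' he' heq
          obtain ⟨h, -⟩ := hsub e he
          obtain ⟨h', -⟩ := hsub e' he'
          simp only [h, h', dif_pos] at heq
          exact congrArg Fin.val heq
      have := hcard c hc
      omega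
    have himg : ∀ e (he : e < E), elem C t e he ∈ S ↔ e ∈ S.image Fin.val := by
      intro e he
      rw [Finset.mem_image]
      exact ⟨fun h => ⟨_, h, rfl⟩, fun ⟨v, hv, hve⟩ => by
        rwa [show elem C t e he = v from Fin.ext hve.symm]⟩
    refine ⟨S.image Fin.val, ?_, hne.image _, Finset.card_image_le.trans hSk, ?_⟩
    · intro e he
      obtain ⟨v, hv, rfl⟩ := Finset.mem_image.1 he
      rcases exists_elem_or_copy v with ⟨e, hlt, rfl⟩ | ⟨c, i, hc, hi, rfl⟩
      · exact Finset.mem_range.2 hlt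
      · exact absurd hv (hcopy c i hc hi)
    · rintro c hc ⟨e, he⟩
      rw [Finset.mem_inter] at he
      have he' := Finset.mem_range.1 (hW c he.1)
      have ht0 : 0 < t := by omega
      have h := hS (copy E c 0 hc ht0) ⟨hcopy c 0 hc ht0, elem C t e he', (himg e he').2 he.2,
        (adj_elem_copy he' hc ht0).2 he.1⟩
      rw [degreeIn_copy hW hc ht0 S _ himg, hcompl S _ himg] at h
      omega
  · rintro ⟨S', hS', ⟨e₀, he₀⟩, hSk, hmaj⟩
    have hlt : ∀ e ∈ S', e < E := fun e he => Finset.mem_range.1 (hS' he)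
    set S : Finset (Fin (E + C * t)) := S'.attach.image fun e => elem C t e.1 (hlt e.1 e.2) with hSdef
    have himg : ∀ e (he : e < E), elem C t e he ∈ S ↔ e ∈ S' := by
      intro e he
      rw [hSdef, Finset.mem_image]
      constructor
      · rintro ⟨e', -, h⟩
        have : (e' : ℕ) = e := congrArg Fin.val h
        exact this ▸ e'.2
      · exact fun h => ⟨⟨e, h⟩, Finset.mem_attach _ _, rfl⟩
    refine ⟨S, ⟨⟨_, (himg e₀ (hlt e₀ he₀)).2 he₀⟩, ?_⟩,
      Finset.card_image_le.trans (by rwa [Finset.card_attach])⟩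
    rintro v ⟨-, u, hu, huv⟩
    obtain ⟨e, -, rfl⟩ := Finset.mem_image.1 hu
    rcases exists_elem_or_copy v with ⟨e', he', rfl⟩ | ⟨c, i, hc, hi, rfl⟩
    -- The graph is bipartite, so `N(S)` contains only copies of sets when `S` contains only
    -- elements.
    · exact absurd huv (not_adj_elem_elem _ he')
    · rw [degreeIn_copy hW hc hi S _ himg, hcompl S _ himg]
      exact hmaj c hc ⟨e, Finset.mem_inter.2 ⟨(adj_elem_copy _ hc hi).1 huv, e.2⟩⟩

end incidenceGraph

/-! ### Selection from groups

There are `g` groups of `h` candidates and `L` slots, some of which carry a constraint; the candidate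
`a` of the group `i` meets the constraint in the slot `j` if `sat j i a`. Elements of the set system
below are the numbers less than `(g + 2) * h - 1`, in blocks of length `h`: a block that every
solution contains, the blocks of candidates of the groups, and a block of padding. -/

namespace Selection

section

variable (g h : ℕ) (valid : ℕ → Prop) (sat : ℕ → ℕ → ℕ → Prop)

open Classical in
/-- The candidates that meet the constraint in slot `j`. -/
noncomputable def good (j : ℕ) : Finset ℕ :=
  (Finset.range ((g + 1) * h)).filter fun e => h ≤ e ∧ sat j (e / h - 1) (e % h)

open Classical in
/-- The part of a set of the system outside the first block. -/
noncomputable def part (c : ℕ) : Finset ℕ :=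
  if c < g then Finset.Ico ((c + 1) * h) ((c + 2) * h)
  else if valid (c - g) then
    good g h sat (c - g) ∪
      Finset.Ico ((g + 1) * h) ((g + 1) * h + (h - (good g h sat (c - g)).card))
  else Finset.Ico ((g + 1) * h) ((g + 2) * h - 1)

/-- The set system: the sets `c < g` ask for a candidate of group `c`, the others for a candidate
that meets the constraint in slot `c - g`. -/
noncomputable def system (c : ℕ) : Finset ℕ := Finset.range h ∪ part g h valid sat c

end

variable {g h L : ℕ} {valid : ℕ → Prop} {sat : ℕ → ℕ → ℕ → Prop}

theorem part_of_lt {c : ℕ} (hc : c < g) :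
    part g h valid sat c = Finset.Ico ((c + 1) * h) ((c + 2) * h) := if_pos hc

theorem part_of_valid {j : ℕ} (hj : valid j) : part g h valid sat (g + j) =
    good g h sat j ∪ Finset.Ico ((g + 1) * h) ((g + 1) * h + (h - (good g h sat j).card)) := by
  rw [part, if_neg (by omega), Nat.add_sub_cancel_left, if_pos hj]

theorem part_of_not_valid {j : ℕ} (hj : ¬ valid j) : part g h valid sat (g + j) =
    Finset.Ico ((g + 1) * h) ((g + 2) * h - 1) := by
  rw [part, if_neg (by omega), Nat.add_sub_cancel_left, if_neg hj]

theorem mem_good {j e : ℕ} : e ∈ good g h sat j ↔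
    e < (g + 1) * h ∧ h ≤ e ∧ sat j (e / h - 1) (e % h) := by
  classical
  rw [good, Finset.mem_filter, Finset.mem_range]

theorem card_part_of_lt {c : ℕ} (hc : c < g) : (part g h valid sat c).card = h := by
  rw [part_of_lt hc, Nat.card_Ico]
  have : (c + 2) * h = (c + 1) * h + h := by ring
  omega

/-- Padding fills the good candidates up to exactly `h`. The whole set then has `2h` elements, and
the common block alone falls one short of a strict majority. -/
theorem card_part_of_valid {j : ℕ} (hj : valid j) (hle : (good g h sat j).card ≤ h) :
    (part g h valid sat (g + j)).card = h := by
  rw [part_of_valid hj, Finset.card_union_of_disjoint, Nat.card_Ico]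
  · omega
  · rw [Finset.disjoint_left]
    intro e he he'
    rw [mem_good] at he
    rw [Finset.mem_Ico] at he'
    omega

/-- With `h - 1` elements here the set has size `2h - 1`, so the common block alone is a strict
majority and an unused slot imposes nothing further. -/
theorem card_part_of_not_valid {j : ℕ} (hj : ¬ valid j) :
    (part g h valid sat (g + j)).card = h - 1 := by
  rw [part_of_not_valid hj, Nat.card_Ico]
  have : (g + 2) * h = (g + 1) * h + h := by ring
  omega

theorem le_of_mem_part {c e : ℕ} (he : e ∈ part g h valid sat c) : h ≤ e := by
  rcases Nat.lt_or_ge c g with hc | hc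
  · rw [part_of_lt hc, Finset.mem_Ico] at he
    have : (c + 1) * h = c * h + h := by ring
    omega
  · obtain ⟨j, rfl⟩ := Nat.exists_eq_add_of_le hc
    have h₁ : (g + 1) * h = g * h + h := by ring
    by_cases hj : valid j
    · rw [part_of_valid hj, Finset.mem_union, mem_good, Finset.mem_Ico] at he
      omega
    · rw [part_of_not_valid hj, Finset.mem_Ico] at he
      omega

theorem card_system (c : ℕ) :
    (system g h valid sat c).card = h + (part g h valid sat c).card := by
  rw [system, Finset.card_union_of_disjoint, Finset.card_range]
  rw [Finset.disjoint_left]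
  intro e he he'
  have := le_of_mem_part he'
  rw [Finset.mem_range] at he
  omega

/-- The padding block has only `h - 1` elements. This suffices because a valid slot has at least one
good candidate. -/
theorem system_subset (hh : 0 < h) (hgood : ∀ j, valid j → 0 < (good g h sat j).card) (c : ℕ) :
    system g h valid sat c ⊆ Finset.range ((g + 2) * h - 1) := by
  have h₁ : (g + 1) * h = g * h + h := by ring
  have h₂ : (g + 2) * h = g * h + h + h := by ring
  intro e he
  rw [system, Finset.mem_union, Finset.mem_range] at he
  rw [Finset.mem_range]
  rcases he with he | he
  · omega
  rcases Nat.lt_or_ge c g with hc | hc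
  · rw [part_of_lt hc, Finset.mem_Ico] at he
    have : (c + 2) * h ≤ (g + 1) * h := Nat.mul_le_mul_right h (by omega)
    omega
  · obtain ⟨j, rfl⟩ := Nat.exists_eq_add_of_le hc
    by_cases hj : valid j
    · rw [part_of_valid hj, Finset.mem_union, mem_good, Finset.mem_Ico] at he
      have := hgood j hj
      omega
    · rw [part_of_not_valid hj, Finset.mem_Ico] at he
      omega

/-- An element in no set would satisfy the majority condition on its own, as a singleton. The
padding block is covered by the set of an unused slot, so one such slot must exist. -/
theorem exists_mem_system (hg : 0 < g) (hL : ∃ j < L, ¬ valid j) {e : ℕ}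
    (he : e < (g + 2) * h - 1) : ∃ c < g + L, e ∈ system g h valid sat c := by
  have h₁ : (g + 1) * h = g * h + h := by ring
  have h₂ : (g + 2) * h = g * h + h + h := by ring
  rcases Nat.lt_or_ge e h with h₃ | h₃
  · exact ⟨0, by omega, Finset.mem_union_left _ (Finset.mem_range.2 h₃)⟩
  rcases Nat.lt_or_ge e ((g + 1) * h) with h₄ | h₄
  · have hh : 0 < h := Nat.pos_of_ne_zero fun h0 => by simp [h0] at h₄
    have h₅ : 1 ≤ e / h := (Nat.one_le_div_iff hh).2 h₃
    have h₆ : e / h < g + 1 := Nat.div_lt_of_lt_mul (h₄.trans_eq (Nat.mul_comm _ _))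
    refine ⟨e / h - 1, by omega, Finset.mem_union_right _ ?_⟩
    rw [part_of_lt (by omega), Finset.mem_Ico, Nat.sub_add_cancel h₅,
      show e / h - 1 + 2 = e / h + 1 by omega]
    exact ⟨Nat.div_mul_le_self e h, Nat.lt_mul_of_div_lt (Nat.lt_succ_self _) (by omega)⟩
  · obtain ⟨j, hj, hj'⟩ := hL
    refine ⟨g + j, by omega, Finset.mem_union_right _ ?_⟩
    rw [part_of_not_valid hj', Finset.mem_Ico]
    omega

theorem card_inter_range_blocks (S : Finset ℕ) (m : ℕ) :
    (S ∩ Finset.range h).card +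
      ∑ i ∈ Finset.range m, (S ∩ Finset.Ico ((i + 1) * h) ((i + 2) * h)).card =
    (S ∩ Finset.range ((m + 1) * h)).card := by
  induction m with
  | zero => simp
  | succ m ih =>
    rw [Finset.sum_range_succ, ← add_assoc, ih, ← Finset.card_union_of_disjoint]
    · congr 1
      have : (m + 2) * h = (m + 1) * h + h := by ring
      ext e
      simp only [Finset.mem_union, Finset.mem_inter, Finset.mem_range, Finset.mem_Ico,
        show m + 1 + 1 = m + 2 from rfl]
      have := Nat.zero_le h
      constructor
      · rintro (⟨h₁, h₂⟩ | ⟨h₁, h₂⟩) <;> exact ⟨h₁, by omega⟩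
      · rintro ⟨h₁, h₂⟩
        rcases Nat.lt_or_ge e ((m + 1) * h) with h₃ | h₃
        exacts [Or.inl ⟨h₁, h₃⟩, Or.inr ⟨h₁, h₃, h₂⟩]
    · rw [Finset.disjoint_left]
      intro e he he'
      simp only [Finset.mem_inter, Finset.mem_range, Finset.mem_Ico] at he he'
      omega

/-- A set of `h + g` elements that contains more than half of each set of the system it meets
corresponds to a choice of one candidate from each group that meets all constraints. -/
theorem exists_majority_iff (hg : 2 ≤ g) (hgh : g + 2 ≤ h)
    (hle : ∀ j, valid j → (good g h sat j).card ≤ h) (hL : ∃ j < L, ¬ valid j) :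
    (∃ S ⊆ Finset.range ((g + 2) * h - 1), S.Nonempty ∧ S.card ≤ h + g ∧
        ∀ c < g + L, (system g h valid sat c ∩ S).Nonempty →
          (system g h valid sat c \ S).card < (system g h valid sat c ∩ S).card) ↔
      ∃ a : ℕ → ℕ, (∀ i < g, a i < h) ∧ ∀ j < L, valid j → ∃ i < g, sat j i (a i) := by
  have e₁ : (g + 1) * h = g * h + h := by ring
  have e₂ : (g + 2) * h = g * h + h + h := by ring
  constructor
  · rintro ⟨S, hSE, hne, hSk, hmaj⟩
    have hsplit : ∀ c, (system g h valid sat c ∩ S).card =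
        (S ∩ Finset.range h).card + (S ∩ part g h valid sat c).card := by
      intro c
      rw [system, Finset.union_inter_distrib_right, Finset.card_union_of_disjoint,
        Finset.inter_comm S, Finset.inter_comm S]
      rw [Finset.disjoint_left]
      intro e he he'
      rw [Finset.mem_inter, Finset.mem_range] at he
      have := le_of_mem_part (Finset.mem_inter.1 he').1
      omega
    have hmaj' : ∀ c < g + L, (system g h valid sat c ∩ S).Nonempty →
        h + (part g h valid sat c).card <
          2 * ((S ∩ Finset.range h).card + (S ∩ part g h valid sat c).card) := by
      intro c hc hcS
      have h₁ := hmaj c hc hcS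
      have h₂ := Finset.card_inter_add_card_sdiff (system g h valid sat c) S
      rw [card_system] at h₂
      rw [hsplit] at h₁ h₂
      omega
    -- A set that `S` meets has at most `h` elements outside the common block, hence at most half of
    -- its elements there; a strict majority needs an element of the block.
    have hF : 0 < (S ∩ Finset.range h).card := by
      obtain ⟨e, he⟩ := hne
      obtain ⟨c, hc, hec⟩ := exists_mem_system (valid := valid) (sat := sat) (by omega) hL
        (Finset.mem_range.1 (hSE he))
      have h₁ := hmaj' c hc ⟨e, Finset.mem_inter.2 ⟨hec, he⟩⟩
      have h₂ : (S ∩ part g h valid sat c).card ≤ (part g h valid sat c).card :=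
        Finset.card_le_card Finset.inter_subset_right
      have h₃ : (part g h valid sat c).card ≤ h := by
        rcases Nat.lt_or_ge c g with hc | hc
        · rw [card_part_of_lt hc]
        · obtain ⟨j, rfl⟩ := Nat.exists_eq_add_of_le hc
          by_cases hj : valid j
          · rw [card_part_of_valid hj (hle j hj)]
          · rw [card_part_of_not_valid hj]; omega
      omega
    have htouch : ∀ c, (system g h valid sat c ∩ S).Nonempty := by
      intro c
      obtain ⟨e, he⟩ := Finset.card_pos.1 hF
      rw [Finset.mem_inter] at he
      exact ⟨e, Finset.mem_inter.2 ⟨Finset.mem_union_left _ he.2, he.1⟩⟩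
    have hgroup : ∀ c < g, h + 1 ≤ (S ∩ Finset.range h).card +
        (S ∩ Finset.Ico ((c + 1) * h) ((c + 2) * h)).card := by
      intro c hc
      have := hmaj' c (by omega) (htouch c)
      rw [card_part_of_lt hc, part_of_lt hc] at this
      omega
    have hsum := card_inter_range_blocks (h := h) S g
    have hpad : (S ∩ Finset.range ((g + 1) * h)).card + (S \ Finset.range ((g + 1) * h)).card ≤
        h + g := by
      rw [Finset.card_inter_add_card_sdiff]
      exact hSk
    have hFle : (S ∩ Finset.range h).card ≤ h :=
      (Finset.card_le_card Finset.inter_subset_right).trans_eq (Finset.card_range h)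
    -- `y` is the number of elements of the common block missing from `S`; each group has to
    -- compensate with `y + 1` candidates.
    obtain ⟨y, hy⟩ := Nat.exists_eq_add_of_le hFle
    have hge : g * (y + 1) ≤
        ∑ i ∈ Finset.range g, (S ∩ Finset.Ico ((i + 1) * h) ((i + 2) * h)).card := by
      rw [← smul_eq_mul]
      refine (Finset.card_nsmul_le_sum (Finset.range g) _ (y + 1) fun i hi => ?_).trans_eq' (by simp)
      have := hgroup i (Finset.mem_range.1 hi)
      omega
    have h2y : 2 * y ≤ g * y := Nat.mul_le_mul_right y hg
    rw [Nat.mul_succ] at hge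
    -- From `h - y + g * (y + 1) ≤ h + g` it follows that `g * y ≤ y`, while `g ≥ 2`.
    have hy0 : y = 0 := by omega
    -- The block and one candidate per group already exhaust the `h + g` elements.
    have hpad0 : (S \ Finset.range ((g + 1) * h)) = ∅ := by
      rw [← Finset.card_eq_zero]; omega
    have hone : ∀ i < g, 1 ≤ (S ∩ Finset.Ico ((i + 1) * h) ((i + 2) * h)).card := by
      intro i hi
      have := hgroup i hi
      omega
    have hone' : ∀ i < g, (S ∩ Finset.Ico ((i + 1) * h) ((i + 2) * h)).card ≤ 1 := by
      intro i hi
      by_contra hlt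
      have : ∑ i ∈ Finset.range g, 1 <
          ∑ i ∈ Finset.range g, (S ∩ Finset.Ico ((i + 1) * h) ((i + 2) * h)).card :=
        Finset.sum_lt_sum (fun j hj => hone j (Finset.mem_range.1 hj))
          ⟨i, Finset.mem_range.2 hi, by omega⟩
      simp only [Finset.sum_const, Finset.card_range, smul_eq_mul, mul_one] at this
      omega
    have hchoice : ∀ i, ∃ e, i < g → e ∈ S ∧ (i + 1) * h ≤ e ∧ e < (i + 2) * h := by
      intro i
      by_cases hi : i < g
      · obtain ⟨e, he⟩ := Finset.card_pos.1 (hone i hi)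
        rw [Finset.mem_inter, Finset.mem_Ico] at he
        exact ⟨e, fun _ => he⟩
      · exact ⟨0, fun h => absurd h hi⟩
    choose b hb using hchoice
    refine ⟨fun i => b i % h, fun i _ => Nat.mod_lt _ (by omega), fun j hj hvj => ?_⟩
    have h₁ := hmaj' (g + j) (by omega) (htouch _)
    rw [card_part_of_valid hvj (hle j hvj)] at h₁
    obtain ⟨e, he⟩ := Finset.card_pos.1 (show 0 < (S ∩ part g h valid sat (g + j)).card by omega)
    rw [Finset.mem_inter, part_of_valid hvj, Finset.mem_union, Finset.mem_Ico, mem_good] at he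
    obtain ⟨heS, ⟨he₁, he₂, he₃⟩ | he⟩ := he
    · have h₅ : 1 ≤ e / h := (Nat.one_le_div_iff (by omega)).2 he₂
      have h₆ : e / h < g + 1 := Nat.div_lt_of_lt_mul (he₁.trans_eq (Nat.mul_comm _ _))
      refine ⟨e / h - 1, by omega, ?_⟩
      have hbe : b (e / h - 1) = e := by
        have hb' := hb (e / h - 1) (by omega)
        refine Finset.card_le_one.1 (hone' (e / h - 1) (by omega)) _ ?_ _ ?_
        · rw [Finset.mem_inter, Finset.mem_Ico]; exact hb'
        · rw [Finset.mem_inter, Finset.mem_Ico, Nat.sub_add_cancel h₅,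
            show e / h - 1 + 2 = e / h + 1 by omega]
          exact ⟨heS, Nat.div_mul_le_self e h, Nat.lt_mul_of_div_lt (Nat.lt_succ_self _) (by omega)⟩
      change sat j _ (b (e / h - 1) % h)
      rw [hbe]
      exact he₃
    -- The extra element needed for the majority cannot be padding, as `S` contains none.
    · have : e ∈ S \ Finset.range ((g + 1) * h) := by
        rw [Finset.mem_sdiff, Finset.mem_range]
        exact ⟨heS, by omega⟩
      rw [hpad0] at this
      exact absurd this (Finset.notMem_empty e)
  · rintro ⟨a, ha, hsat⟩
    set S : Finset ℕ := Finset.range h ∪ (Finset.range g).image fun i => (i + 1) * h + a i with hS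
    have hmem : ∀ i < g, (i + 1) * h + a i ∈ S := fun i hi =>
      Finset.mem_union_right _ (Finset.mem_image_of_mem _ (Finset.mem_range.2 hi))
    have hlt : ∀ i < g, (i + 1) * h + a i < (i + 2) * h := fun i hi => by
      have := ha i hi
      have : (i + 2) * h = (i + 1) * h + h := by ring
      omega
    have hFS : Finset.range h ⊆ S := Finset.subset_union_left
    refine ⟨S, ?_, ⟨0, hFS (Finset.mem_range.2 (by omega))⟩, ?_, ?_⟩
    · refine Finset.union_subset (fun e he => ?_) (fun e he => ?_)
      · rw [Finset.mem_range] at *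
        omega
      · obtain ⟨i, hi, rfl⟩ := Finset.mem_image.1 he
        rw [Finset.mem_range] at hi
        have := hlt i hi
        have : (i + 2) * h ≤ (g + 1) * h := Nat.mul_le_mul_right h (by omega)
        rw [Finset.mem_range]
        omega
    · refine (Finset.card_union_le _ _).trans ?_
      rw [Finset.card_range]
      exact Nat.add_le_add_left (Finset.card_image_le.trans_eq (Finset.card_range g)) h
    · intro c hc _
      -- The block with one further element of the part makes `h + 1` out of at most `2h`.
      have hhit : ∀ e, e ∈ part g h valid sat c → e ∈ S → (part g h valid sat c).card ≤ h →
          (system g h valid sat c \ S).card < (system g h valid sat c ∩ S).card := by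
        intro e he heS hcard
        have h₁ : h + 1 ≤ (system g h valid sat c ∩ S).card := by
          have : (insert e (Finset.range h)).card = h + 1 := by
            rw [Finset.card_insert_of_notMem, Finset.card_range]
            rw [Finset.mem_range]
            have := le_of_mem_part he
            omega
          rw [← this]
          refine Finset.card_le_card (Finset.insert_subset ?_ ?_)
          · exact Finset.mem_inter.2 ⟨Finset.mem_union_right _ he, heS⟩
          · exact Finset.subset_inter Finset.subset_union_left hFS
        have h₂ := Finset.card_inter_add_card_sdiff (system g h valid sat c) S
        rw [card_system] at h₂
        omega
      rcases Nat.lt_or_ge c g with hcg | hcg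
      · refine hhit ((c + 1) * h + a c) ?_ (hmem c hcg) (card_part_of_lt hcg).le
        rw [part_of_lt hcg, Finset.mem_Ico]
        exact ⟨Nat.le_add_right _ _, hlt c hcg⟩
      · obtain ⟨j, rfl⟩ := Nat.exists_eq_add_of_le hcg
        by_cases hj : valid j
        · obtain ⟨i, hi, hsi⟩ := hsat j (by omega) hj
          refine hhit ((i + 1) * h + a i) ?_ (hmem i hi) (card_part_of_valid hj (hle j hj)).le
          rw [part_of_valid hj, Finset.mem_union, mem_good]
          left
          have := hlt i hi
          have h₄ : (i + 2) * h ≤ (g + 1) * h := Nat.mul_le_mul_right h (by omega)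
          have h₅ : (i + 1) * h = i * h + h := by ring
          have h₆ : ((i + 1) * h + a i) / h = i + 1 := by
            rw [Nat.add_comm, Nat.add_mul_div_right _ _ (by omega), Nat.div_eq_of_lt (ha i hi),
              Nat.zero_add]
          have h₇ : ((i + 1) * h + a i) % h = a i := by
            rw [Nat.add_comm, Nat.add_mul_mod_self_right, Nat.mod_eq_of_lt (ha i hi)]
          refine ⟨by omega, by omega, ?_⟩
          rw [h₆, h₇]
          exact hsi
        -- An unused slot is met in at least `h` of its `2h - 1` elements.
        · have h₁ : h ≤ (system g h valid sat (g + j) ∩ S).card := by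
            conv_lhs => rw [← Finset.card_range h]
            exact Finset.card_le_card (Finset.subset_inter Finset.subset_union_left hFS)
          have h₂ := Finset.card_inter_add_card_sdiff (system g h valid sat (g + j)) S
          rw [card_system, card_part_of_not_valid hj] at h₂
          omega

end Selection

/-! ### The instance constructed from the code of a formula -/

/-- The number of `1`s in `x` from position `p` on, counted for `i` steps at most. -/
def unaryRun (x : List Bool) (p : ℕ) : ℕ → ℕ
  | 0 => 0
  | i + 1 => unaryRun x p i + bitAt x (p + unaryRun x p i)

/-- The number whose unary code starts at position `p` of `x`. -/
def unaryAt (x : List Bool) (p : ℕ) : ℕ := unaryRun x p x.length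

/-- The position in the code `x` of a formula at which the code of the `l`-th literal starts. -/
def litStart (x : List Bool) : ℕ → ℕ
  | 0 => unaryAt x 0 + 1
  | l + 1 => litStart x l + 2 + unaryAt x (litStart x l + 1)

namespace AllianceReduction

variable (x : List Bool)

/-- The number of variables. -/
def numVars : ℕ := unaryAt x 0

/-- The number of variables in a group. -/
def width : ℕ := Nat.log 4 (numVars x) + 1

/-- The number of groups of variables. -/
def groups : ℕ := numVars x / width x + 2

/-- One of the two extra groups provides for a last incomplete group; together they guarantee `g ≥
2`, which forces the common block into every solution. -/
theorem two_le_groups : 2 ≤ groups x := Nat.le_add_left _ _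

/-- The number of candidates in a group; the first `2 ^ width x` are the assignments. -/
def size : ℕ := 3 * 2 ^ width x + groups x

/-- The assignment `a` of group `i` makes the `l`-th literal true. -/
def LitHolds (l i a : ℕ) : Prop :=
  unaryAt x (litStart x l + 1) / width x = i ∧
    a / 2 ^ (unaryAt x (litStart x l + 1) % width x) % 2 = bitAt x (litStart x l)

/-- There is a `j`-th clause. -/
def Valid (j : ℕ) : Prop := litStart x (3 * j) < x.length

/-- The candidate `a` of group `i` makes the `j`-th clause true. -/
def Sat (j i a : ℕ) : Prop :=
  a < 2 ^ width x ∧ (LitHolds x (3 * j) i a ∨ LitHolds x (3 * j + 1) i a ∨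
    LitHolds x (3 * j + 2) i a)

/-- The instance of Offensive Alliance constructed from the code of a formula. -/
noncomputable def toInstance : OffensiveAllianceInstance where
  numVertices := ((groups x + 2) * size x - 1) +
    (groups x + x.length) * (2 * (size x + groups x))
  graph := incidenceGraph _ _ _ (Selection.system (groups x) (size x) (Valid x) (Sat x))
  k := size x + groups x
  k_pos := by have := two_le_groups x; omega

/-- A good candidate makes one of three literals true. The literal determines its group, and within
the group only the `2 ^ width x` genuine assignments count, so there are at most `3 * 2 ^ width x`
of them. -/
theorem card_good_le (j : ℕ) :
    (Selection.good (groups x) (size x) (Sat x) j).card ≤ size x := by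
  have h : Selection.good (groups x) (size x) (Sat x) j ⊆
      (Finset.range 3 ×ˢ Finset.range (2 ^ width x)).image fun p =>
        (unaryAt x (litStart x (3 * j + p.1) + 1) / width x + 1) * size x + p.2 := by
    intro e he
    obtain ⟨-, he₁, hlt, hsat⟩ := Selection.mem_good.1 he
    have hpos : 0 < size x := by have := two_le_groups x; unfold size; omega
    have h₁ : 1 ≤ e / size x := (Nat.one_le_div_iff hpos).2 he₁
    have key : ∀ l < 3, unaryAt x (litStart x (3 * j + l) + 1) / width x = e / size x - 1 →
        e ∈ (Finset.range 3 ×ˢ Finset.range (2 ^ width x)).image fun p =>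
          (unaryAt x (litStart x (3 * j + p.1) + 1) / width x + 1) * size x + p.2 := by
      intro l hl heq
      refine Finset.mem_image.2 ⟨(l, e % size x), Finset.mem_product.2
        ⟨Finset.mem_range.2 hl, Finset.mem_range.2 hlt⟩, ?_⟩
      change (unaryAt x (litStart x (3 * j + l) + 1) / width x + 1) * size x + e % size x = e
      rw [heq, Nat.sub_add_cancel h₁]
      exact Nat.div_add_mod' e (size x)
    rcases hsat with h | h | h
    exacts [key 0 (by omega) h.1, key 1 (by omega) h.1, key 2 (by omega) h.1]
  refine (Finset.card_le_card h).trans (Finset.card_image_le.trans ?_)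
  rw [Finset.card_product, Finset.card_range, Finset.card_range]
  unfold size
  omega

end AllianceReduction

/-! ### Reading the code of a formula -/

theorem bitAt_eq_of_drop {x y : List Bool} {p i : ℕ} (h : x.drop p = y) :
    bitAt x (p + i) = (y.getD i false).toNat := by
  subst h
  simp [bitAt, List.getD_eq_getElem?_getD]

/-- The position read is `p` plus the count so far, so the scan stalls on the terminating `0` and
surplus steps add nothing. -/
theorem unaryRun_eq {x rest : List Bool} {p v : ℕ}
    (h : x.drop p = unaryCode v ++ rest) (i : ℕ) : unaryRun x p i = min i v := by
  induction i with
  | zero => simp [unaryRun]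
  | succ i ih =>
    rw [unaryRun, ih, bitAt_eq_of_drop h]
    rcases Nat.lt_or_ge i v with hi | hi
    · rw [Nat.min_eq_left hi.le, Nat.min_eq_left hi]
      simp [unaryCode, List.getD_eq_getElem?_getD, List.getElem?_append, hi]
    · rw [Nat.min_eq_right hi, Nat.min_eq_right (by omega)]
      simp [unaryCode, List.getD_eq_getElem?_getD]

theorem unaryAt_eq {x rest : List Bool} {p v : ℕ}
    (h : x.drop p = unaryCode v ++ rest) : unaryAt x p = v := by
  rw [unaryAt, unaryRun_eq h, min_eq_right]
  have := congrArg List.length h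
  simp [unaryCode] at this
  omega

theorem litStart_succ_of_drop {x rest : List Bool} {l v : ℕ} {s : Bool}
    (h : x.drop (litStart x l) = s :: unaryCode v ++ rest) :
    bitAt x (litStart x l) = s.toNat ∧ unaryAt x (litStart x l + 1) = v ∧
      x.drop (litStart x (l + 1)) = rest := by
  have h₁ : x.drop (litStart x l + 1) = unaryCode v ++ rest := by
    rw [← List.drop_drop, h]
    rfl
  have h₂ := unaryAt_eq h₁
  refine ⟨?_, h₂, ?_⟩
  · have := bitAt_eq_of_drop (i := 0) h
    simpa using this
  · rw [litStart, h₂, show litStart x l + 2 + v = litStart x l + 1 + (v + 1) by omega,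
      ← List.drop_drop, h₁, List.drop_left']
    simp [unaryCode]

theorem litStart_mono (x : List Bool) : Monotone (litStart x) :=
  monotone_nat_of_le_succ fun l => by rw [litStart]; omega

namespace ThreeCNF

variable (φ : ThreeCNF)

/-- The code of a clause. -/
def clauseCode {n : ℕ} (c : Fin 3 → Fin n × Bool) : List Bool :=
  (List.finRange 3).flatMap fun i => (c i).2 :: unaryCode ((c i).1 : ℕ)

theorem clauseCode_append {n : ℕ} (c : Fin 3 → Fin n × Bool) (rest : List Bool) :
    clauseCode c ++ rest = (c 0).2 :: unaryCode ((c 0).1 : ℕ) ++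
      ((c 1).2 :: unaryCode ((c 1).1 : ℕ) ++ ((c 2).2 :: unaryCode ((c 2).1 : ℕ) ++ rest)) := by
  simp [clauseCode, List.finRange_succ]

theorem unaryAt_encode_zero : unaryAt φ.encode 0 = φ.numVars :=
  unaryAt_eq (rest := φ.clauses.flatMap clauseCode) rfl

/-- Each clause is consumed by three literal steps. Beyond the last clause both sides are empty,
because `litStart` never decreases. -/
theorem drop_litStart (j : ℕ) :
    φ.encode.drop (litStart φ.encode (3 * j)) = (φ.clauses.drop j).flatMap clauseCode := by
  induction j with
  | zero =>
    rw [Nat.mul_zero, litStart, unaryAt_encode_zero, List.drop_zero]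
    exact List.drop_left' (by simp [unaryCode])
  | succ j ih =>
    rcases Nat.lt_or_ge j φ.clauses.length with hj | hj
    · rw [List.drop_eq_getElem_cons hj, List.flatMap_cons, clauseCode_append] at ih
      exact (litStart_succ_of_drop (litStart_succ_of_drop (litStart_succ_of_drop ih).2.2).2.2).2.2
    · rw [List.drop_eq_nil_of_le hj] at ih
      rw [List.drop_eq_nil_of_le (by omega : φ.clauses.length ≤ j + 1)]
      rw [List.flatMap_nil, List.drop_eq_nil_iff] at ih ⊢
      exact ih.trans (litStart_mono _ (by omega))

theorem valid_encode_iff {j : ℕ} :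
    AllianceReduction.Valid φ.encode j ↔ j < φ.clauses.length := by
  have h := drop_litStart φ j
  unfold AllianceReduction.Valid
  constructor
  · intro hlt
    by_contra hj
    rw [List.drop_eq_nil_of_le (by omega : φ.clauses.length ≤ j), List.flatMap_nil,
      List.drop_eq_nil_iff] at h
    omega
  · intro hj
    by_contra hlt
    rw [List.drop_eq_nil_of_le (by omega), List.drop_eq_getElem_cons hj, List.flatMap_cons,
      clauseCode_append] at h
    simp at h

theorem literal_encode {j : ℕ} (hj : j < φ.clauses.length) (i : Fin 3) :
    unaryAt φ.encode (litStart φ.encode (3 * j + i) + 1) = (φ.clauses[j] i).1 ∧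
      bitAt φ.encode (litStart φ.encode (3 * j + i)) = (φ.clauses[j] i).2.toNat := by
  have h := drop_litStart φ j
  rw [List.drop_eq_getElem_cons hj, List.flatMap_cons, clauseCode_append] at h
  have h₀ := litStart_succ_of_drop h
  have h₁ := litStart_succ_of_drop h₀.2.2
  have h₂ := litStart_succ_of_drop h₁.2.2
  fin_cases i
  exacts [⟨h₀.2.1, h₀.1⟩, ⟨h₁.2.1, h₁.1⟩, ⟨h₂.2.1, h₂.1⟩]

/-- There are as many slots as bits in the code, so this leaves at least one slot unused, as
`Selection.exists_majority_iff` requires. -/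
theorem clauses_length_lt : φ.clauses.length < φ.encode.length := by
  have h' : ∀ l : List (Fin 3 → Fin φ.numVars × Bool),
      l.length ≤ (l.flatMap clauseCode).length := by
    intro l
    induction l with
    | nil => simp
    | cons c l ih =>
      rw [List.flatMap_cons, clauseCode_append]
      simp only [List.length_append, List.length_cons]
      omega
  have h₁ : φ.encode.length = φ.numVars + 1 + (φ.clauses.flatMap clauseCode).length := by
    change (unaryCode φ.numVars ++ φ.clauses.flatMap clauseCode).length = _
    rw [List.length_append]
    simp [unaryCode]
  have := h' φ.clauses
  omega

end ThreeCNF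

/-! ### Correctness of the reduction -/

theorem div_two_pow_mod_two (a t : ℕ) : a / 2 ^ t % 2 = (a.testBit t).toNat := by
  rw [Nat.testBit_eq_decide_div_mod_eq]
  rcases Nat.mod_two_eq_zero_or_one (a / 2 ^ t) with h | h <;> simp [h]

namespace AllianceReduction

variable (φ : ThreeCNF)

theorem sat_encode_iff {j : ℕ} (hj : j < φ.clauses.length) {i a : ℕ} :
    Sat φ.encode j i a ↔ a < 2 ^ width φ.encode ∧ ∃ l : Fin 3,
      ((φ.clauses[j] l).1 : ℕ) / width φ.encode = i ∧
        a.testBit ((φ.clauses[j] l).1 % width φ.encode) = (φ.clauses[j] l).2 := by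
  have h : ∀ l : Fin 3, LitHolds φ.encode (3 * j + l) i a ↔
      ((φ.clauses[j] l).1 : ℕ) / width φ.encode = i ∧
        a.testBit ((φ.clauses[j] l).1 % width φ.encode) = (φ.clauses[j] l).2 := by
    intro l
    rw [LitHolds, (φ.literal_encode hj l).1, (φ.literal_encode hj l).2, div_two_pow_mod_two,
      (by decide : ∀ p q : Bool, p.toNat = q.toNat ↔ p = q)]
  unfold Sat
  rw [Fin.exists_fin_succ, Fin.exists_fin_two, ← h, ← h, ← h]
  rfl

theorem width_pos (x : List Bool) : 0 < width x := Nat.succ_pos _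

theorem div_width_lt (v : Fin φ.numVars) : (v : ℕ) / width φ.encode < groups φ.encode := by
  unfold groups numVars
  rw [φ.unaryAt_encode_zero]
  have := Nat.div_le_div_right (c := width φ.encode) v.2.le
  omega

/-- The first literal of the clause can be made true within its group by `0` or by a single power of
two. -/
theorem card_good_pos {j : ℕ} (hj : j < φ.clauses.length) :
    0 < (Selection.good (groups φ.encode) (size φ.encode) (Sat φ.encode) j).card := by
  have hw := width_pos φ.encode
  set v := (φ.clauses[j] 0).1 with hv
  obtain ⟨a, ha, ha'⟩ : ∃ a < 2 ^ width φ.encode,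
      a.testBit (v % width φ.encode) = (φ.clauses[j] 0).2 := by
    cases (φ.clauses[j] 0).2 with
    | false => exact ⟨0, Nat.two_pow_pos _, by simp⟩
    | true =>
      exact ⟨2 ^ ((v : ℕ) % width φ.encode),
        Nat.pow_lt_pow_right (by omega) (Nat.mod_lt _ hw), by simp⟩
  have hi := div_width_lt φ v
  set i := (v : ℕ) / width φ.encode with hidef
  have hah : a < size φ.encode := by unfold size; omega
  refine Finset.card_pos.2 ⟨(i + 1) * size φ.encode + a, Selection.mem_good.2 ⟨?_, ?_, ?_⟩⟩
  · have : (i + 2) * size φ.encode ≤ (groups φ.encode + 1) * size φ.encode :=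
      Nat.mul_le_mul_right _ (by omega)
    have : (i + 2) * size φ.encode = (i + 1) * size φ.encode + size φ.encode := by ring
    omega
  · have : (i + 1) * size φ.encode = i * size φ.encode + size φ.encode := by ring
    omega
  · have h₆ : ((i + 1) * size φ.encode + a) / size φ.encode = i + 1 := by
      rw [Nat.add_comm, Nat.add_mul_div_right _ _ (by omega), Nat.div_eq_of_lt hah,
        Nat.zero_add]
    have h₇ : ((i + 1) * size φ.encode + a) % size φ.encode = a := by
      rw [Nat.add_comm, Nat.add_mul_mod_self_right, Nat.mod_eq_of_lt hah]
    rw [h₆, h₇, Nat.add_sub_cancel, sat_encode_iff φ hj]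
    exact ⟨ha, 0, rfl, ha'⟩

/-- A choice of candidates that make all clauses true is a satisfying assignment. -/
theorem exists_choice_iff :
    (∃ a : ℕ → ℕ, (∀ i < groups φ.encode, a i < size φ.encode) ∧ ∀ j < φ.encode.length,
      Valid φ.encode j → ∃ i < groups φ.encode, Sat φ.encode j i (a i)) ↔ φ.Satisfiable := by
  have hw := width_pos φ.encode
  constructor
  · rintro ⟨a, -, ha⟩
    -- Variable `v` is bit `v % width` of the candidate chosen in group `v / width`. A dummy
    -- candidate also yields some bits here, which does no harm.
    refine ⟨fun v => (a (v / width φ.encode)).testBit (v % width φ.encode), fun c hc => ?_⟩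
    obtain ⟨j, hj, rfl⟩ := List.getElem_of_mem hc
    obtain ⟨i, -, hi⟩ := ha j (hj.trans φ.clauses_length_lt) (φ.valid_encode_iff.2 hj)
    obtain ⟨-, l, hl, hl'⟩ := (sat_encode_iff φ hj).1 hi
    refine ⟨l, ?_⟩
    rw [← hl] at hl'
    exact hl'
  · rintro ⟨α, hα⟩
    -- The last groups have positions without a variable; their bits are set to `false`.
    set β : ℕ → Bool := fun v => if hv : v < φ.numVars then α ⟨v, hv⟩ else false with hβ
    refine ⟨fun i => Nat.ofBits fun t : Fin (width φ.encode) => β (i * width φ.encode + t),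
      fun i _ => ?_, fun j hj hjv => ?_⟩
    · refine (Nat.ofBits_lt_two_pow _).trans_le ?_
      unfold size
      omega
    · rw [φ.valid_encode_iff] at hjv
      obtain ⟨l, hl⟩ := hα _ (List.getElem_mem hjv)
      refine ⟨((φ.clauses[j] l).1 : ℕ) / width φ.encode, div_width_lt φ _, ?_⟩
      rw [sat_encode_iff φ hjv]
      refine ⟨Nat.ofBits_lt_two_pow _, l, rfl, ?_⟩
      rw [Nat.testBit_ofBits_lt _ _ (Nat.mod_lt _ hw)]
      simp only [Nat.div_add_mod', hβ, Fin.is_lt, dif_pos]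
      exact hl

theorem toInstance_isYes_iff : (toInstance φ.encode).IsYes ↔ φ.Satisfiable := by
  rw [← exists_choice_iff]
  have hg := two_le_groups φ.encode
  have hgh : groups φ.encode + 2 ≤ size φ.encode := by
    have := Nat.two_pow_pos (width φ.encode)
    unfold size
    omega
  have hL : ∃ j < φ.encode.length, ¬ Valid φ.encode j :=
    ⟨φ.clauses.length, φ.clauses_length_lt, fun h => absurd (φ.valid_encode_iff.1 h) (lt_irrefl _)⟩
  rw [← Selection.exists_majority_iff hg hgh (fun j _ => card_good_le _ j) hL]
  refine incidenceGraph.exists_isOffensiveAlliance_iff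
    (Selection.system_subset (by omega) fun j hj => card_good_pos φ (φ.valid_encode_iff.1 hj))
    (toInstance φ.encode).k_pos le_rfl fun c hc => ?_
  change size φ.encode + groups φ.encode < _
  -- The smallest sets have `2h - 1` elements, and `h ≥ g + 2` makes this larger than `k = h + g`.
  rw [Selection.card_system]
  rcases Nat.lt_or_ge c (groups φ.encode) with hc | hc
  · rw [Selection.card_part_of_lt hc]; omega
  · obtain ⟨j, rfl⟩ := Nat.exists_eq_add_of_le hc
    by_cases hj : Valid φ.encode j
    · rw [Selection.card_part_of_valid hj (card_good_le _ j)]; omega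
    · rw [Selection.card_part_of_not_valid hj]; omega

end AllianceReduction

/-! ### More functions computed in polynomial time -/

namespace StackProg

namespace PolyFn

variable {n : ℕ} {F G H : List Bool → (Fin n → ℕ) → ℕ}

theorem comp₁ {f : List Bool → ℕ → ℕ} (hf : PolyFn fun x (ρ : Fin 1 → ℕ) => f x (ρ 0))
    (hF : PolyFn F) : PolyFn fun x ρ => f x (F x ρ) :=
  hF.letIn (hf.reindex (m := n + 1) ![0])

theorem sum_range {G : List Bool → (Fin (n + 1) → ℕ) → ℕ} (hF : PolyFn F) (hG : PolyFn G) :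
    PolyFn fun x ρ => ∑ i ∈ Finset.range (F x ρ), G x (Fin.cons i ρ) := by
  obtain ⟨p, hp⟩ := hF.exists_bound
  obtain ⟨q, hq⟩ := hG.exists_bound
  refine natRec (const 0) hF ((proj 0).add hG.weaken)
    (fun x ρ m => ∑ i ∈ Finset.range m, G x (Fin.cons i ρ)) (fun x ρ => by simp)
    (fun x ρ i => ?_) (p * q.comp (Polynomial.X + p)) (fun x ρ B hx hρ m hm => ?_)
  · simp [Finset.sum_range_succ]
  · have hp' := hp x ρ B hx hρ
    rw [Polynomial.eval_mul, Polynomial.eval_comp, Polynomial.eval_add, Polynomial.eval_X]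
    calc ∑ i ∈ Finset.range m, G x (Fin.cons i ρ)
        ≤ ∑ _i ∈ Finset.range m, q.eval (B + p.eval B) := by
          refine Finset.sum_le_sum fun i hi => hq x _ _ (by omega) fun j => ?_
          rw [Finset.mem_range] at hi
          induction j using Fin.cases with
          | zero => rw [Fin.cons_zero]; omega
          | succ j => rw [Fin.cons_succ]; have := hρ j; omega
      _ = m * q.eval (B + p.eval B) := by simp
      _ ≤ _ := Nat.mul_le_mul_right _ (hm.trans hp')

end PolyFn

open Classical in
/-- A predicate whose truth value is computed in polynomial time. -/
def PolyPred {n : ℕ} (p : List Bool → (Fin n → ℕ) → Prop) : Prop :=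
  PolyFn fun x ρ => if p x ρ then 1 else 0

namespace PolyPred

variable {n : ℕ} {p q : List Bool → (Fin n → ℕ) → Prop} {F G : List Bool → (Fin n → ℕ) → ℕ}

theorem of_iff (hp : PolyPred p) (h : ∀ x ρ, p x ρ ↔ q x ρ) : PolyPred q := by
  have : p = q := funext fun x => funext fun ρ => propext (h x ρ)
  exact this ▸ hp

theorem not (hp : PolyPred p) : PolyPred fun x ρ => ¬ p x ρ :=
  PolyFn.of_eq ((PolyFn.const 1).sub hp) fun x ρ => by by_cases h : p x ρ <;> simp [h]

theorem and (hp : PolyPred p) (hq : PolyPred q) : PolyPred fun x ρ => p x ρ ∧ q x ρ :=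
  PolyFn.of_eq (PolyFn.mul hp hq) fun x ρ => by
    by_cases h : p x ρ <;> by_cases h' : q x ρ <;> simp [h, h']

theorem or (hp : PolyPred p) (hq : PolyPred q) : PolyPred fun x ρ => p x ρ ∨ q x ρ :=
  (hp.not.and hq.not).not.of_iff fun x ρ => by tauto

theorem le (hF : PolyFn F) (hG : PolyFn G) : PolyPred fun x ρ => F x ρ ≤ G x ρ :=
  PolyFn.of_eq ((PolyFn.const 1).sub (hF.sub hG)) fun x ρ => by
    by_cases h : F x ρ ≤ G x ρ
    · simp [h]
    · simp only [h, if_false]; omega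

theorem lt (hF : PolyFn F) (hG : PolyFn G) : PolyPred fun x ρ => F x ρ < G x ρ :=
  (le hG hF).not.of_iff fun _ _ => not_le

theorem eq (hF : PolyFn F) (hG : PolyFn G) : PolyPred fun x ρ => F x ρ = G x ρ :=
  ((le hF hG).and (le hG hF)).of_iff fun _ _ => le_antisymm_iff.symm

open Classical in
theorem card_filter_range {P : List Bool → (Fin (n + 1) → ℕ) → Prop} (hF : PolyFn F)
    (hP : PolyPred P) : PolyFn fun x ρ =>
      ((Finset.range (F x ρ)).filter fun i => P x (Fin.cons i ρ)).card :=
  (PolyFn.sum_range hF hP).of_eq fun x ρ => by rw [Finset.card_filter]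

open Classical in
theorem decide (hp : PolyPred p) : PolyWord fun x ρ => [decide (p x ρ)] :=
  (PolyWord.singleton hp).of_eq fun x ρ => by by_cases h : p x ρ <;> simp [h]

end PolyPred

namespace PolyFn

variable {n : ℕ} {F G : List Bool → (Fin n → ℕ) → ℕ}

/-- The quotient is the number of `i < F` with `(i + 1) * G ≤ F`. The condition `1 ≤ G` enforces the
convention that division by zero gives `0`. -/
theorem div (hF : PolyFn F) (hG : PolyFn G) : PolyFn fun x ρ => F x ρ / G x ρ := by
  classical
  refine of_eq (PolyPred.card_filter_range hF (P := fun x ρ =>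
    1 ≤ G x (Fin.tail ρ) ∧ (ρ 0 + 1) * G x (Fin.tail ρ) ≤ F x (Fin.tail ρ)) ?_) fun x ρ => ?_
  · exact (PolyPred.le (const 1) hG.weaken).and
      (PolyPred.le (((proj 0).add (const 1)).mul hG.weaken) hF.weaken)
  · simp only [Fin.tail_cons, Fin.cons_zero]
    rcases Nat.eq_zero_or_pos (G x ρ) with h | h
    · simp [h]
    · rw [← Finset.card_range (F x ρ / G x ρ)]
      congr 1
      ext i
      simp only [Finset.mem_filter, Finset.mem_range]
      rw [← Nat.succ_le_iff (m := i) (n := F x ρ / G x ρ), Nat.le_div_iff_mul_le h]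
      constructor
      · exact fun hi => hi.2.2
      · intro hi
        refine ⟨?_, h, hi⟩
        have : i + 1 ≤ (i + 1) * G x ρ := Nat.le_mul_of_pos_right _ h
        exact (Nat.lt_succ_self i).trans_le (this.trans hi)

theorem mod (hF : PolyFn F) (hG : PolyFn G) : PolyFn fun x ρ => F x ρ % G x ρ :=
  (hF.sub (hG.mul (hF.div hG))).of_eq fun _ _ => (Nat.mod_eq_sub _ _).symm

/-- Repeated division by `b` avoids the power `b ^ G`, which may be exponentially large. -/
theorem div_pow (b : ℕ) (hF : PolyFn F) (hG : PolyFn G) : PolyFn fun x ρ => F x ρ / b ^ G x ρ := by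
  obtain ⟨p, hp⟩ := hF.exists_bound
  refine natRec hF hG ((proj 0).div (const b)) (fun x ρ i => F x ρ / b ^ i) (fun x ρ => by simp)
    (fun x ρ i => ?_) p (fun x ρ B hx hρ i _ => (Nat.div_le_self _ _).trans (hp x ρ B hx hρ))
  simp [pow_succ, Nat.div_div_eq_div_mul]

theorem log (b : ℕ) (hb : 1 < b) (hF : PolyFn F) : PolyFn fun x ρ => Nat.log b (F x ρ) := by
  classical
  refine of_eq (PolyPred.card_filter_range hF (P := fun x ρ =>
    1 ≤ F x (Fin.tail ρ) / b ^ (ρ 0 + 1)) ?_) fun x ρ => ?_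
  · exact PolyPred.le (const 1) (hF.weaken.div_pow b ((proj 0).add (const 1)))
  · simp only [Fin.tail_cons, Fin.cons_zero]
    rw [← Finset.card_range (Nat.log b (F x ρ))]
    congr 1
    ext i
    simp only [Finset.mem_filter, Finset.mem_range]
    rw [Nat.one_le_div_iff (Nat.pow_pos (by omega)), ← Nat.succ_le_iff (m := i)]
    constructor
    · exact fun hi => Nat.le_log_of_pow_le hb hi.2
    · intro hi
      have h0 : F x ρ ≠ 0 := by rintro h; rw [h] at hi; simp at hi
      have h1 := Nat.pow_le_of_le_log h0 hi
      exact ⟨(Nat.lt_pow_self hb).trans_le ((Nat.pow_le_pow_right (by omega) (Nat.le_succ i)).trans h1),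
        h1⟩

/-- A unary power cannot be computed in polynomial time in general; the bound `G` keeps the repeated
doubling polynomial. -/
theorem two_pow (hF : PolyFn F) (hG : PolyFn G) (hle : ∀ x ρ, 2 ^ F x ρ ≤ G x ρ) :
    PolyFn fun x ρ => 2 ^ F x ρ := by
  obtain ⟨p, hp⟩ := hG.exists_bound
  refine natRec (const 1) hF ((proj 0).mul (const 2)) (fun x ρ i => 2 ^ i) (fun x ρ => by simp)
    (fun x ρ i => by simp [pow_succ]) p (fun x ρ B hx hρ i hi => ?_)
  exact (Nat.pow_le_pow_right (by omega) hi).trans ((hle x ρ).trans (hp x ρ B hx hρ))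

end PolyFn

end StackProg

open StackProg

/-! ### The reduction is computed in polynomial time -/

theorem unaryRun_le (x : List Bool) (p i : ℕ) : unaryRun x p i ≤ i := by
  induction i with
  | zero => simp [unaryRun]
  | succ i ih =>
    have : bitAt x (p + unaryRun x p i) ≤ 1 := Bool.toNat_le _
    rw [unaryRun]
    omega

theorem unaryAt_le (x : List Bool) (p : ℕ) : unaryAt x p ≤ x.length := unaryRun_le _ _ _

/-- `PolyFn` makes a claim about all bit strings, so the bound is needed for words that encode no
formula as well. -/
theorem litStart_le (x : List Bool) (l : ℕ) : litStart x l ≤ (l + 1) * (x.length + 2) := by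
  induction l with
  | zero =>
    have := unaryAt_le x 0
    rw [litStart]
    omega
  | succ l ih =>
    have := unaryAt_le x (litStart x l + 1)
    rw [litStart, Nat.succ_mul]
    omega

namespace AllianceReduction

variable {n : ℕ} {F G H : List Bool → (Fin n → ℕ) → ℕ}

theorem polyFn_unaryAt (hF : PolyFn F) : PolyFn fun x ρ => unaryAt x (F x ρ) := by
  refine PolyFn.comp₁ (f := unaryAt) ?_ hF
  refine PolyFn.natRec (PolyFn.const 0) PolyFn.length
    -- In the loop body, variable `0` is the count so far, `1` the loop index and `2` the position
    -- `p`.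
    ((PolyFn.proj 0).add ((PolyFn.proj 2).add (PolyFn.proj 0)).bit)
    (fun x ρ i => unaryRun x (ρ 0) i) (fun _ _ => rfl) (fun x ρ i => rfl) Polynomial.X
    (fun x ρ B hx hρ i hi => ?_)
  rw [Polynomial.eval_X]
  exact (unaryRun_le _ _ _).trans (hi.trans hx)

theorem polyFn_litStart (hF : PolyFn F) : PolyFn fun x ρ => litStart x (F x ρ) := by
  refine PolyFn.comp₁ (f := litStart) ?_ hF
  refine PolyFn.natRec ((polyFn_unaryAt (PolyFn.const 0)).add (PolyFn.const 1)) (PolyFn.proj 0)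
    (((PolyFn.proj 0).add (PolyFn.const 2)).add
      (polyFn_unaryAt ((PolyFn.proj 0).add (PolyFn.const 1))))
    (fun x ρ i => litStart x i) (fun _ _ => rfl) (fun x ρ i => rfl)
    ((Polynomial.X + 1) * (Polynomial.X + 2)) (fun x ρ B hx hρ i hi => ?_)
  simp only [Polynomial.eval_mul, Polynomial.eval_add, Polynomial.eval_X, Polynomial.eval_one,
    Polynomial.eval_ofNat]
  have := hρ 0
  exact (litStart_le x i).trans (Nat.mul_le_mul (by omega) (by omega))

theorem polyFn_numVars : PolyFn fun x (_ : Fin n → ℕ) => numVars x :=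
  polyFn_unaryAt (PolyFn.const 0)

theorem polyFn_width : PolyFn fun x (_ : Fin n → ℕ) => width x :=
  (polyFn_numVars.log 4 (by norm_num)).add (PolyFn.const 1)

theorem polyFn_groups : PolyFn fun x (_ : Fin n → ℕ) => groups x :=
  (polyFn_numVars.div polyFn_width).add (PolyFn.const 2)

/-- The number of assignments of a group is of the order of the square root of the number of
variables. -/
theorem two_pow_width_sq_le (x : List Bool) : (2 ^ width x) ^ 2 ≤ 4 * (numVars x + 1) := by
  rw [← pow_mul, Nat.mul_comm, pow_mul, width, pow_succ, Nat.mul_comm]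
  refine Nat.mul_le_mul_left 4 ?_
  rcases Nat.eq_zero_or_pos (numVars x) with h | h
  · simp [h]
  · exact (Nat.pow_log_le_self 4 h.ne').trans (Nat.le_succ _)

theorem polyFn_two_pow_width : PolyFn fun x (_ : Fin n → ℕ) => 2 ^ width x := by
  refine polyFn_width.two_pow ((PolyFn.const 4).mul (polyFn_numVars.add (PolyFn.const 1)))
    fun x ρ => ?_
  have h := two_pow_width_sq_le x
  exact (Nat.le_self_pow (by norm_num) _).trans h

theorem polyFn_size : PolyFn fun x (_ : Fin n → ℕ) => size x :=
  ((PolyFn.const 3).mul polyFn_two_pow_width).add polyFn_groups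

theorem polyPred_litHolds (hF : PolyFn F) (hG : PolyFn G) (hH : PolyFn H) :
    PolyPred fun x ρ => LitHolds x (F x ρ) (G x ρ) (H x ρ) := by
  have hv := polyFn_unaryAt ((polyFn_litStart hF).add (PolyFn.const 1))
  exact (PolyPred.eq (hv.div polyFn_width) hG).and
    (PolyPred.eq ((hH.div_pow 2 (hv.mod polyFn_width)).mod (PolyFn.const 2))
      (polyFn_litStart hF).bit)

theorem polyPred_valid (hF : PolyFn F) : PolyPred fun x ρ => Valid x (F x ρ) :=
  PolyPred.lt (polyFn_litStart ((PolyFn.const 3).mul hF)) PolyFn.length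

theorem polyPred_sat (hF : PolyFn F) (hG : PolyFn G) (hH : PolyFn H) :
    PolyPred fun x ρ => Sat x (F x ρ) (G x ρ) (H x ρ) := by
  have h3 := (PolyFn.const 3).mul hF
  exact (PolyPred.lt hH polyFn_two_pow_width).and ((polyPred_litHolds h3 hG hH).or
    ((polyPred_litHolds (h3.add (PolyFn.const 1)) hG hH).or
      (polyPred_litHolds (h3.add (PolyFn.const 2)) hG hH)))

theorem polyPred_mem_good (hF : PolyFn F) (hG : PolyFn G) : PolyPred fun x ρ =>
    F x ρ ∈ Selection.good (groups x) (size x) (Sat x) (G x ρ) :=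
  ((PolyPred.lt hF ((polyFn_groups.add (PolyFn.const 1)).mul polyFn_size)).and
    ((PolyPred.le polyFn_size hF).and (polyPred_sat hG
      ((hF.div polyFn_size).sub (PolyFn.const 1)) (hF.mod polyFn_size)))).of_iff
    fun _ _ => Selection.mem_good.symm

theorem polyFn_card_good (hF : PolyFn F) : PolyFn fun x ρ =>
    (Selection.good (groups x) (size x) (Sat x) (F x ρ)).card := by
  classical
  refine PolyFn.of_eq (PolyPred.card_filter_range
    ((polyFn_groups.add (PolyFn.const 1)).mul polyFn_size)
    (polyPred_mem_good (PolyFn.proj 0) hF.weaken)) fun x ρ => ?_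
  congr 1
  ext e
  simp only [Finset.mem_filter, Finset.mem_range, Fin.cons_zero, Fin.tail_cons]
  exact ⟨fun h => h.2, fun h => ⟨(Selection.mem_good.1 h).1, h⟩⟩

/-- Membership as a Boolean combination of comparisons, so that the closure properties of `PolyPred`
apply. -/
theorem mem_system_iff {g h : ℕ} {valid : ℕ → Prop} {sat : ℕ → ℕ → ℕ → Prop} {e c : ℕ} :
    e ∈ Selection.system g h valid sat c ↔ e < h ∨
      ((c < g ∧ ((c + 1) * h ≤ e ∧ e < (c + 2) * h)) ∨
      (¬ c < g ∧ ((valid (c - g) ∧ (e ∈ Selection.good g h sat (c - g) ∨ ((g + 1) * h ≤ e ∧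
        e < (g + 1) * h + (h - (Selection.good g h sat (c - g)).card)))) ∨
      (¬ valid (c - g) ∧ ((g + 1) * h ≤ e ∧ e < (g + 2) * h - 1))))) := by
  rw [Selection.system, Finset.mem_union, Finset.mem_range, Selection.part]
  by_cases hc : c < g
  · simp [hc]
  · by_cases hv : valid (c - g) <;> simp [hc, hv]

theorem polyPred_mem_system (hF : PolyFn F) (hG : PolyFn G) : PolyPred fun x ρ =>
    F x ρ ∈ Selection.system (groups x) (size x) (Valid x) (Sat x) (G x ρ) := by
  have hs := hG.sub polyFn_groups
  have h₁ := (polyFn_groups.add (PolyFn.const 1)).mul (polyFn_size (n := n))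
  have h₂ := (polyFn_groups.add (PolyFn.const 2)).mul (polyFn_size (n := n))
  refine PolyPred.of_iff (PolyPred.or (PolyPred.lt hF polyFn_size) (PolyPred.or
    ((PolyPred.lt hG polyFn_groups).and
      ((PolyPred.le ((hG.add (PolyFn.const 1)).mul polyFn_size) hF).and
        (PolyPred.lt hF ((hG.add (PolyFn.const 2)).mul polyFn_size))))
    ((PolyPred.lt hG polyFn_groups).not.and (PolyPred.or
      ((polyPred_valid hs).and ((polyPred_mem_good hF hs).or ((PolyPred.le h₁ hF).and
        (PolyPred.lt hF (h₁.add (polyFn_size.sub (polyFn_card_good hs)))))))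
      ((polyPred_valid hs).not.and ((PolyPred.le h₁ hF).and
        (PolyPred.lt hF (h₂.sub (PolyFn.const 1)))))))))
    fun x ρ => mem_system_iff.symm

theorem polyWord_unaryCode (hF : PolyFn F) : PolyWord fun x ρ => unaryCode (F x ρ) := by
  refine PolyWord.of_eq ((PolyWord.flatMap_range hF
    (PolyWord.singleton (PolyFn.const 1))).append (PolyWord.singleton (PolyFn.const 0)))
    fun x ρ => ?_
  rw [unaryCode]
  congr 1
  induction F x ρ with
  | zero => rfl
  | succ m ih => rw [List.range_succ, List.flatMap_append, ih, List.replicate_succ']; rfl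

theorem polyWord_encode_toInstance :
    PolyWord fun x (_ : Fin 0 → ℕ) => (toInstance x).encode := by
  classical
  have hE : ∀ {n}, PolyFn fun x (_ : Fin n → ℕ) => (groups x + 2) * size x - 1 :=
    ((polyFn_groups.add (PolyFn.const 2)).mul polyFn_size).sub (PolyFn.const 1)
  have hk : ∀ {n}, PolyFn fun x (_ : Fin n → ℕ) => size x + groups x :=
    polyFn_size.add polyFn_groups
  have hk2 : ∀ {n}, PolyFn fun x (_ : Fin n → ℕ) => 2 * (size x + groups x) :=
    (PolyFn.const 2).mul hk
  have hV : ∀ {n}, PolyFn fun x (_ : Fin n → ℕ) => (toInstance x).numVertices :=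
    hE.add ((polyFn_groups.add PolyFn.length).mul hk2)
  have hinc : ∀ i j : Fin 2, PolyPred fun x (ρ : Fin 2 → ℕ) =>
      ρ i < (groups x + 2) * size x - 1 ∧ ((groups x + 2) * size x - 1 ≤ ρ j ∧
        ρ i ∈ Selection.system (groups x) (size x) (Valid x) (Sat x)
          ((ρ j - ((groups x + 2) * size x - 1)) / (2 * (size x + groups x)))) := fun i j =>
    (PolyPred.lt (PolyFn.proj i) hE).and ((PolyPred.le hE (PolyFn.proj j)).and
      (polyPred_mem_system (PolyFn.proj i) (((PolyFn.proj j).sub hE).div hk2)))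
  -- The inner loop binds last: variable `0` is the column and variable `1` the row of the adjacency
  -- matrix.
  have hadj := (PolyPred.or (hinc 1 0) (hinc 0 1)).decide
  refine PolyWord.of_eq (((polyWord_unaryCode hV).append (polyWord_unaryCode hk)).append
    (PolyWord.flatMap_range hV (PolyWord.flatMap_range hV hadj))) fun x ρ => ?_
  rw [OffensiveAllianceInstance.encode]
  congr 1
  have hfin : ∀ (m : ℕ) (f : ℕ → List Bool),
      (List.range m).flatMap f = (List.finRange m).flatMap fun u : Fin m => f u := by
    intro m f
    rw [← List.map_coe_finRange_eq_range, List.flatMap_map]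
  rw [hfin]
  refine congrArg (fun f => List.flatMap f _) (funext fun u => ?_)
  rw [hfin, List.map_eq_flatMap]
  refine congrArg (fun f => List.flatMap f _) (funext fun v => ?_)
  congr 1

end AllianceReduction

/-! ### The parameter of the constructed instance -/

namespace AllianceReduction

/-- Here the group width pays off. With `w` the width, `k = 3 * 2 ^ w + 2 * g` is at most `2 ^ (2 *
w + 4)`, so `log k = O(w)`; and both `w * 2 ^ w ≤ 4 ^ w` and `w * g ≤ n + 2 * w` are `O(n + 1)`. -/
theorem param_mul_log_le (x : List Bool) :
    ((toInstance x).k : ℝ) * Real.log (toInstance x).k ≤ 180 * ((numVars x : ℝ) + 1) := by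
  have hk : (toInstance x).k = 3 * 2 ^ width x + 2 * groups x := by
    change size x + groups x = _
    unfold size
    ring
  have hsq := two_pow_width_sq_le x
  have hw1 : 1 ≤ width x := width_pos x
  have h2 : 2 ≤ 2 ^ width x := by
    calc 2 = 2 ^ 1 := rfl
      _ ≤ _ := Nat.pow_le_pow_right (by omega) hw1
  have hle : width x ≤ 2 ^ width x := Nat.lt_two_pow_self.le
  have hlt : numVars x < 4 ^ width x := Nat.lt_pow_succ_log_self (by norm_num) _
  have hgw : width x * groups x ≤ numVars x + 2 * width x := by
    unfold groups
    rw [Nat.mul_add, Nat.mul_comm _ 2]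
    exact Nat.add_le_add_right (Nat.mul_div_le _ _) _
  have hg : groups x ≤ numVars x + 2 := Nat.add_le_add_right (Nat.div_le_self _ _) 2
  have hkle : (toInstance x).k ≤ 2 ^ (2 * width x + 4) := by
    rw [pow_add, pow_mul, hk]
    have : (2 ^ 2) ^ width x = 4 ^ width x := by norm_num
    rw [this]
    nlinarith
  have hlog : Real.log (toInstance x).k ≤ 6 * (width x : ℝ) := by
    have hpos : (0 : ℝ) < (toInstance x).k := by exact_mod_cast (toInstance x).k_pos
    calc Real.log (toInstance x).k ≤ Real.log ((2 : ℝ) ^ (2 * width x + 4)) :=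
          Real.log_le_log hpos (by exact_mod_cast hkle)
      _ = (2 * width x + 4 : ℕ) * Real.log 2 := Real.log_pow _ _
      _ ≤ (2 * width x + 4 : ℕ) * 1 := by
          gcongr
          exact Real.log_two_lt_d9.le.trans (by norm_num)
      _ ≤ 6 * (width x : ℝ) := by
          have : (2 * width x + 4 : ℕ) ≤ 6 * width x := by omega
          rw [mul_one]
          exact_mod_cast this
  have hnat : (toInstance x).k * (6 * width x) ≤ 180 * (numVars x + 1) := by
    have h₁ : 2 ^ width x * width x ≤ (2 ^ width x) ^ 2 := by
      rw [sq]
      exact Nat.mul_le_mul_left _ hle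
    have h₂ : width x ≤ (2 ^ width x) ^ 2 := hle.trans (Nat.le_self_pow (by norm_num) _)
    calc (toInstance x).k * (6 * width x)
        = 18 * (2 ^ width x * width x) + 12 * (width x * groups x) := by rw [hk]; ring
      _ ≤ 180 * (numVars x + 1) := by omega
  calc ((toInstance x).k : ℝ) * Real.log (toInstance x).k
      ≤ (toInstance x).k * (6 * (width x : ℝ)) := by gcongr
    _ ≤ 180 * ((numVars x : ℝ) + 1) := by exact_mod_cast hnat

end AllianceReduction

/-! ### Comparison of exponents and conclusion -/

open AllianceReduction in
theorem exists_rpow_le_of_isLittleO {f : ℕ → ℝ}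
    (hf : Asymptotics.IsLittleO Filter.atTop f (fun k : ℕ => (k : ℝ) * Real.log (k : ℝ)))
    {δ : ℝ} (hδ : 0 < δ) : ∃ C : ℕ, ∀ x : List Bool,
      (2 : ℝ) ^ f (toInstance x).k ≤ C * (2 : ℝ) ^ (δ * (numVars x : ℝ)) := by
  obtain ⟨K, hK⟩ := Filter.eventually_atTop.1 (hf.def (show 0 < δ / 180 by positivity))
  -- The finitely many `k < K`, where the asymptotic bound says nothing, are absorbed into the
  -- constant `C`.
  set M : ℝ := ∑ k ∈ Finset.range K, |f k| with hM
  have hM0 : 0 ≤ M := Finset.sum_nonneg fun _ _ => abs_nonneg _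
  obtain ⟨C, hC⟩ := exists_nat_ge ((2 : ℝ) ^ (δ + M))
  refine ⟨C, fun x => ?_⟩
  have hfk : f (toInstance x).k ≤ (δ + M) + δ * numVars x := by
    rcases Nat.lt_or_ge (toInstance x).k K with h | h
    · have h₁ : |f (toInstance x).k| ≤ M :=
        Finset.single_le_sum (f := fun k => |f k|) (fun _ _ => abs_nonneg _)
          (Finset.mem_range.2 h)
      have := le_abs_self (f (toInstance x).k)
      have : 0 ≤ δ * (numVars x : ℝ) := by positivity
      linarith
    · have h₁ := hK _ h
      have h₂ := param_mul_log_le x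
      have h₃ : 0 ≤ ((toInstance x).k : ℝ) * Real.log (toInstance x).k :=
        mul_nonneg (Nat.cast_nonneg _) (Real.log_natCast_nonneg _)
      rw [Real.norm_eq_abs, Real.norm_eq_abs, abs_of_nonneg h₃] at h₁
      have h₄ := le_abs_self (f (toInstance x).k)
      have h₅ : δ / 180 * (((toInstance x).k : ℝ) * Real.log (toInstance x).k) ≤
          δ / 180 * (180 * ((numVars x : ℝ) + 1)) := by gcongr
      linarith
  calc (2 : ℝ) ^ f (toInstance x).k ≤ 2 ^ ((δ + M) + δ * numVars x) :=
        Real.rpow_le_rpow_of_exponent_le (by norm_num) hfk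
    _ = 2 ^ (δ + M) * 2 ^ (δ * (numVars x : ℝ)) := Real.rpow_add (by norm_num) _ _
    _ ≤ C * 2 ^ (δ * (numVars x : ℝ)) := by gcongr

theorem mainTheorem3 (eth : ExponentialTimeHypothesis) :
    ¬ ∃ f : ℕ → ℝ,
      Asymptotics.IsLittleO Filter.atTop f (fun k : ℕ => (k : ℝ) * Real.log (k : ℝ)) ∧
      SolvableInOStar OffensiveAllianceInstance.encode OffensiveAllianceInstance.IsYes
        (fun I => (2 : ℝ) ^ f I.k) := by
  rintro ⟨f, hf, hsolv⟩
  obtain ⟨δ, hδ, hno⟩ := eth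
  obtain ⟨C, hC⟩ := exists_rpow_le_of_isLittleO hf hδ
  refine hno (hsolv.of_reduction AllianceReduction.polyWord_encode_toInstance
    (fun φ => AllianceReduction.toInstance φ.encode) (fun _ _ => rfl)
    AllianceReduction.toInstance_isYes_iff (fun φ => Real.one_le_rpow (by norm_num) (by positivity))
    C fun φ => ?_)
  have h := hC φ.encode
  rwa [AllianceReduction.numVars, φ.unaryAt_encode_zero] at h
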